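/- Let $S$ be a non-trivial affine monoid, i.e. a commutative, cancellative, finitely generated, torsion-free monoid (written additively) with $S\neq\{0\}$, and let $D$ be an integral domain. Then the monoid algebra $D[S]$ is a weakly Krull domain if and only if $D$ is a weakly Krull domain, $D$ is a UMT-domain, and $S$ is a weakly Krull monoid. Here a domain $D$ is *weakly Krull* if $D=\bigcap_{P} D_P$ inside its quotient field, where $P$ runs over the height-one prime ideals of $D$, and every non-zero non-unit of $D$ lies in only finitely many height-one primes. A monoid $S$ is *weakly Krull* if $S=\bigcap_{P} S_P$ inside its quotient group, where $P$ runs over the minimal non-empty prime ideals of $S$ and $S_P=\{a-b\mid a\in S,\ b\in S\setminus P\}$, and every non-unit of $S$ lies in only finitely many minimal non-empty prime ideals. (Empty intersections are the whole quotient field, resp. quotient group.) A domain $D$ is a *UMT-domain* if every non-zero prime ideal $Q$ of $D[X]$ with $Q\cap D=(0)$ is a maximal $t$-ideal of $D[X]$, i.e. maximal among the proper ideals $I$ with $I=I_t$, where $I_t=\bigcup_J J_v$ is taken over the finitely generated ideals $J\subseteq I$, and $J_v=(J^{-1})^{-1}$ with $J^{-1}=\{x \mid xJ\subseteq D[X]\}$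 in the quotient field of $D[X]$ for $J\ne 0$ and $0_v=0$. -/

import Mathlib

namespace WeaklyKrull

open scoped nonZeroDivisors

section Domain

/-- The height-one spectrum of a commutative ring. -/
def heightOnePrimes (D : Type*) [CommRing D] : Set (PrimeSpectrum D) :=
  {P | P.asIdeal.height = 1}

/-- A domain `D` is weakly Krull if, inside its quotient field, `D` is the intersection of the
localizations `D_P` at the height-one primes `P` (an empty intersection being the whole quotient
field), and every non-zero non-unit lies in only finitely many height-one primes. -/
structure IsWeaklyKrullDomain (D : Type*) [CommRing D] [IsDomain D] : Prop where
  iInf_localization_eq_bot :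
    (⨅ P ∈ heightOnePrimes D, Localization.subalgebra.ofField (FractionRing D)
      P.asIdeal.primeCompl P.asIdeal.primeCompl_le_nonZeroDivisors) = ⊥
  finite_character : ∀ x : D, x ≠ 0 → ¬ IsUnit x →
    {P ∈ heightOnePrimes D | x ∈ P.asIdeal}.Finite

/-- The `v`-closure `J_v = (J⁻¹)⁻¹` of an ideal `J`, where `J⁻¹ = {x ∈ K | x J ⊆ A}` in the
quotient field `K` of `A` for `J ≠ 0`, and `0_v = 0`. -/
noncomputable def vClosure {A : Type*} [CommRing A] [IsDomain A] (J : Ideal A) :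
    FractionalIdeal A⁰ (FractionRing A) :=
  ((J : FractionalIdeal A⁰ (FractionRing A))⁻¹)⁻¹

/-- The `t`-closure `I_t` of an ideal `I`: the union of the `J_v` over all finitely generated
ideals `J ⊆ I`. -/
def tClosure {A : Type*} [CommRing A] [IsDomain A] (I : Ideal A) : Set (FractionRing A) :=
  {x | ∃ J : Ideal A, J.FG ∧ J ≤ I ∧ x ∈ vClosure J}

/-- `I` is a `t`-ideal if `I_t = I`. -/
def IsTIdeal {A : Type*} [CommRing A] [IsDomain A] (I : Ideal A) : Prop :=
  tClosure I = algebraMap A (FractionRing A) '' (I : Set A)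

/-- Maximal `t`-ideals: the maximal elements among the proper `t`-ideals. -/
def IsMaximalTIdeal {A : Type*} [CommRing A] [IsDomain A] (I : Ideal A) : Prop :=
  Maximal (fun J : Ideal A => J ≠ ⊤ ∧ IsTIdeal J) I

/-- A domain `D` is a UMT-domain if every upper to zero in `D[X]`, that is, every non-zero prime
ideal of `D[X]` lying over `(0)`, is a maximal `t`-ideal. -/
def IsUMTDomain (D : Type*) [CommRing D] [IsDomain D] : Prop :=
  ∀ Q : Ideal (Polynomial D), Q.IsPrime → Q ≠ ⊥ → Q.comap Polynomial.C = ⊥ → IsMaximalTIdeal Q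

end Domain

section Monoid

/-- Prime ideals of a commutative (additive) monoid. The empty set is allowed, and is prime. -/
structure IsPrimeIdeal {S : Type*} [AddCommMonoid S] (P : Set S) : Prop where
  add_mem : ∀ (s : S) {p : S}, p ∈ P → s + p ∈ P
  ne_univ : P ≠ Set.univ
  mem_or_mem : ∀ {a b : S}, a + b ∈ P → a ∈ P ∨ b ∈ P

/-- The minimal non-empty prime ideals of a monoid. -/
def minimalPrimeIdeals (S : Type*) [AddCommMonoid S] : Set (Set S) :=
  {P | Minimal (fun Q : Set S => Q.Nonempty ∧ IsPrimeIdeal Q) P}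

/-- The localization `S_P = {a - b | a ∈ S, b ∈ S \ P}` inside the quotient group of `S`. -/
def localizationAt {S : Type*} [AddCommMonoid S] (P : Set S) :
    Set (Algebra.GrothendieckAddGroup S) :=
  {x | ∃ a b : S, b ∉ P ∧
    x = Algebra.GrothendieckAddGroup.of a - Algebra.GrothendieckAddGroup.of b}

/-- A cancellative commutative monoid `S` is weakly Krull if, inside its quotient group, `S` is the
intersection of the localizations `S_P` at its minimal non-empty primes `P` (an empty intersection
being the whole quotient group), and every non-unit lies in only finitely many of these primes. -/
structure IsWeaklyKrullMonoid (S : Type*) [AddCancelCommMonoid S] : Prop where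
  iInter_localization_eq :
    (⋂ P ∈ minimalPrimeIdeals S, localizationAt P) =
      Set.range (Algebra.GrothendieckAddGroup.of : S →+ Algebra.GrothendieckAddGroup S)
  finite_character : ∀ a : S, ¬ IsAddUnit a → {P ∈ minimalPrimeIdeals S | a ∈ P}.Finite

end Monoid

end WeaklyKrull

/-! Everything turns on when a height-one prime `p` of `D` extends to a height-one prime `p[S]` of
`D[S]`. For `S ≠ 0` this happens exactly when `p[X]` contains no upper to zero of `D[X]`, and over a
weakly Krull `D` the latter condition, for all such `p`, is the UMT property.

If a non-zero prime `Q ⊆ p[S]` lies over zero, take a valuation ring of the quotient field of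
`D[S]/Q` centered on `p[S]/Q`. The monomials have residues linearly independent over the residue
field of `p`, yet a non-zero element of `Q` is a linear relation between them over `K = Frac D`.
Hence some `u ∈ K` has residue transcendental over that field, and the kernel of `X ↦ u` is an upper
to zero inside `p[X]` (`exists_upper_to_zero_of_le_extIdeal`). Conversely, an upper inside `p[X]` is
carried into `D[S]` by `X ↦ X^s` and refuted by restriction to a line `t + ℤs`
(`exists_coeff_notMem_of_extIdeal_height_eq_one`).

Sufficiency: `K[G]`, with `G` the quotient group of `S`, is factorial and is the localization of
`D[S]` at its non-zero monomials. A fraction lying in all localizations at height-one primes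
therefore has a monomial denominator. Its exponent is removed by the primes `D[P]`, with `P` minimal
in `S`, and its coefficient by the primes `p[S]`.

Necessity: height-one primes are `t`-ideals, so if `p[S]` had larger height, prime avoidance would
produce a fraction outside `D` lying in every localization of `D[S]` at a height-one prime. Both
weak Krull properties then descend by testing on constants and on monomials. -/

namespace WeaklyKrull

open scoped nonZeroDivisors Polynomial
open Algebra (GrothendieckAddGroup)

/-! ### Height-one primes and `t`-ideals of a domain -/

section Domain

variable {A : Type*} [CommRing A] [IsDomain A]

lemma height_eq_one_iff {P : Ideal A} (hP : P.IsPrime) :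
    P.height = 1 ↔ P ≠ ⊥ ∧ ∀ Q : Ideal A, Q.IsPrime → Q ≤ P → Q ≠ ⊥ → Q = P := by
  constructor
  · intro h
    refine ⟨Ideal.ne_bot_of_height_eq_one h, fun Q hQ hQP hQ0 => ?_⟩
    by_contra hne
    have h1 := (Ideal.height_le_iff (n := 1)).mp h.le Q hQ (lt_of_le_of_ne hQP hne)
    rw [Nat.cast_one, Order.lt_one_iff, Ideal.height_eq_zero_iff_eq_bot] at h1
    exact hQ0 h1
  · rintro ⟨h0, h⟩
    apply le_antisymm
    · rw [show (1 : ℕ∞) = ((1 : ℕ) : ℕ∞) from rfl, Ideal.height_le_iff]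
      intro Q hQ hlt
      rw [Nat.cast_one, Order.lt_one_iff, Ideal.height_eq_zero_iff_eq_bot]
      by_contra hQ0
      exact hlt.ne (h Q hQ hlt.le hQ0)
    · rw [Order.one_le_iff_ne_zero, Ne, Ideal.height_eq_zero_iff_eq_bot]
      exact h0

/-- Clearing denominators: `x / y` lies in `A_P` exactly when `y ∣ b * x` for some `b ∉ P`. All
later arguments use this divisibility form. -/
lemma isWeaklyKrullDomain_iff : IsWeaklyKrullDomain A ↔
    (∀ x y : A, y ≠ 0 →
      (∀ P : Ideal A, P.IsPrime → P.height = 1 → ∃ b ∉ P, y ∣ b * x) → y ∣ x) ∧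
    ∀ x : A, x ≠ 0 → {P : Ideal A | P.IsPrime ∧ P.height = 1 ∧ x ∈ P}.Finite := by
  have hinj := IsFractionRing.injective A (FractionRing A)
  constructor
  · rintro ⟨h1, h2⟩
    refine ⟨fun x y hy h => ?_, fun x hx => ?_⟩
    · have hy' : algebraMap A (FractionRing A) y ≠ 0 := by
        rwa [Ne, map_eq_zero_iff _ hinj]
      have : algebraMap A (FractionRing A) x * (algebraMap A (FractionRing A) y)⁻¹ ∈
          (⊥ : Subalgebra A (FractionRing A)) := by
        rw [← h1]
        simp only [Algebra.mem_iInf]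
        intro P hP
        obtain ⟨b, hb, c, hc⟩ := h P.asIdeal P.isPrime hP
        have hb' : algebraMap A (FractionRing A) b ≠ 0 := by
          rw [Ne, map_eq_zero_iff _ hinj]
          rintro rfl
          exact hb (zero_mem _)
        refine ⟨c, b, hb, ?_⟩
        rw [← div_eq_mul_inv, ← div_eq_mul_inv, div_eq_div_iff hy' hb', ← map_mul, ← map_mul,
          mul_comm x, hc, mul_comm]
      rw [Algebra.mem_bot] at this
      obtain ⟨z, hz⟩ := this
      refine ⟨z, hinj ?_⟩
      rw [map_mul, hz]
      field_simp
    · by_cases hu : IsUnit x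
      · refine Set.Finite.subset Set.finite_empty ?_
        rintro P ⟨hP, -, hx⟩
        exact hP.ne_top (Ideal.eq_top_of_isUnit_mem _ hx hu)
      · refine ((h2 x hx hu).image PrimeSpectrum.asIdeal).subset ?_
        rintro P ⟨hP, hP1, hxP⟩
        exact ⟨⟨P, hP⟩, ⟨hP1, hxP⟩, rfl⟩
  · rintro ⟨h1, h2⟩
    refine ⟨?_, fun x hx _ => ?_⟩
    · rw [eq_bot_iff]
      intro z hz
      simp only [Algebra.mem_iInf] at hz
      obtain ⟨x, y, hy, rfl⟩ := IsFractionRing.div_surjective (A := A) z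
      have hy0 : y ≠ 0 := nonZeroDivisors.ne_zero hy
      have hy' : algebraMap A (FractionRing A) y ≠ 0 := by
        rwa [Ne, map_eq_zero_iff _ hinj]
      obtain ⟨c, hc⟩ := h1 x y hy0 fun P hP hP1 => by
        obtain ⟨a, s, hs, e⟩ := hz ⟨P, hP⟩ hP1
        have hs' : algebraMap A (FractionRing A) s ≠ 0 := by
          rw [Ne, map_eq_zero_iff _ hinj]
          rintro rfl
          exact hs (zero_mem _)
        refine ⟨s, hs, a, hinj ?_⟩
        rw [← div_eq_mul_inv, div_eq_div_iff hy' hs', ← map_mul, ← map_mul] at e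
        rw [mul_comm, e, mul_comm]
      rw [Algebra.mem_bot]
      refine ⟨c, ?_⟩
      rw [hc, map_mul]
      field_simp
    · refine Set.Finite.of_finite_image ((h2 x hx).subset ?_)
        (f := PrimeSpectrum.asIdeal) fun P _ Q _ h => PrimeSpectrum.ext h
      rintro _ ⟨P, ⟨hP1, hxP⟩, rfl⟩
      exact ⟨P.isPrime, hP1, hxP⟩

/-- The localization of `A` at a height-one prime has no other non-zero primes. -/
lemma exists_dvd_mul_pow_of_height_eq_one {P : Ideal A} (hP : P.IsPrime) (h1 : P.height = 1)
    {d : A} (hd : d ≠ 0) {a : A} (ha : a ∈ P) : ∃ n : ℕ, ∃ s ∉ P, d ∣ s * a ^ n := by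
  by_contra! H
  -- A prime containing `d` and avoiding both the complement of `P` and the powers of `a` is a
  -- non-zero prime inside `P`, hence equal to `P`; but `a ∈ P`.
  obtain ⟨Q, hQ, hdQ, hdis⟩ := Ideal.exists_le_prime_disjoint (Ideal.span {d})
    (P.primeCompl ⊔ Submonoid.powers a) <| by
      rw [Set.disjoint_left]
      intro x hx hx'
      obtain ⟨s, hs, _, ⟨n, rfl⟩, rfl⟩ := Submonoid.mem_sup.mp hx'
      exact H n s hs (Ideal.mem_span_singleton.mp hx)
  have hQP : Q ≤ P := by
    intro x hx
    by_contra hxP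
    exact Set.disjoint_left.mp hdis hx (Submonoid.mem_sup_left (S := P.primeCompl) hxP)
  have hQ0 : Q ≠ ⊥ := by
    rintro rfl
    exact hd (by simpa using hdQ (Ideal.mem_span_singleton_self d))
  have := ((height_eq_one_iff hP).mp h1).2 Q hQ hQP hQ0
  subst this
  exact Set.disjoint_left.mp hdis ha
    (Submonoid.mem_sup_right (Submonoid.mem_powers a))

/-- The contraction to `A` of the ideal generated by `a` in the localization at `P`. -/
def localizedSpan (P : Ideal A) [P.IsPrime] (a : A) : Ideal A :=
  { carrier := {x | ∃ s ∉ P, a ∣ s * x}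
    add_mem' := by
      rintro x x' ⟨s, hs, h⟩ ⟨s', hs', h'⟩
      refine ⟨s * s', fun h => (Ideal.IsPrime.mem_or_mem ‹_› h).elim hs hs', ?_⟩
      rw [mul_add]
      exact dvd_add (by rw [mul_right_comm]; exact h.mul_right _)
        (by rw [mul_assoc]; exact h'.mul_left _)
    zero_mem' := ⟨1, P.one_notMem, by simp⟩
    smul_mem' := by
      rintro c x ⟨s, hs, h⟩
      exact ⟨s, hs, by rw [smul_eq_mul, mul_left_comm]; exact h.mul_left _⟩ }

/-- A height-one prime is a `t`-ideal: an element outside of it is separated from a finitely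
generated subideal by some fraction `c / a`. -/
lemma exists_separating_fraction {P : Ideal A} (hP : P.IsPrime) (h1 : P.height = 1)
    {J : Ideal A} (hJ : J.FG) (hJP : J ≤ P) {y : A} (hy : y ∉ P) :
    ∃ c a : A, a ≠ 0 ∧ (∀ j ∈ J, a ∣ c * j) ∧ ¬ a ∣ c * y := by
  obtain ⟨a, haP, ha0⟩ := (Submodule.ne_bot_iff P).mp (Ideal.ne_bot_of_height_eq_one h1)
  set N : Ideal A := localizedSpan P a with hN
  have hrad : J ≤ N.radical := by
    intro j hj
    obtain ⟨n, s, hs, h⟩ := exists_dvd_mul_pow_of_height_eq_one hP h1 ha0 (hJP hj)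
    exact ⟨n, s, hs, h⟩
  obtain ⟨n, hn⟩ := Ideal.exists_pow_le_of_le_radical_of_fg hrad hJ
  have hex : ∃ n, J ^ n ≤ N := ⟨n, hn⟩
  classical
  -- With `m` minimal such that `J ^ m` lies in `aA_P ∩ A`, an element `c` of `J ^ (m - 1)` outside
  -- that ideal satisfies `cJ ⊆ aA_P`, while `c / a` is not in `A_P`.
  set m := Nat.find hex with hm
  have hmN : J ^ m ≤ N := Nat.find_spec hex
  obtain ⟨k, hk⟩ : ∃ k, m = k + 1 := by
    refine Nat.exists_eq_succ_of_ne_zero fun h0 => ?_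
    rw [h0, pow_zero, Ideal.one_eq_top] at hmN
    obtain ⟨s, hs, h⟩ := hmN (Submodule.mem_top (x := 1))
    rw [mul_one] at h
    exact hs (P.mem_of_dvd h haP)
  have hkN : ¬ J ^ k ≤ N := Nat.find_min hex (by omega)
  obtain ⟨c, hcJ, hcN⟩ := SetLike.not_le_iff_exists.mp hkN
  -- a common denominator for the finitely generated ideal `J * c`
  obtain ⟨T, hT⟩ := hJ
  have hcT : ∀ t ∈ T, ∃ s ∉ P, a ∣ s * (c * t) := by
    intro t ht
    have : c * t ∈ N := by
      apply hmN
      rw [hk, pow_succ]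
      exact Ideal.mul_mem_mul hcJ (hT ▸ Ideal.subset_span ht)
    exact this
  choose! s hs hdvd using hcT
  refine ⟨(∏ t ∈ T, s t) * c, a, ha0, fun j hj => ?_, fun h => hcN ?_⟩
  · rw [← hT] at hj
    induction hj using Submodule.span_induction with
    | mem t ht =>
      obtain ⟨r, hr⟩ := Finset.dvd_prod_of_mem s ht
      rw [hr, mul_assoc, mul_right_comm]
      exact (hdvd t ht).mul_right r
    | zero => simp
    | add x y _ _ hx hy => rw [mul_add]; exact dvd_add hx hy
    | smul r x _ hx => rw [smul_eq_mul, mul_left_comm]; exact hx.mul_left r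
  · refine ⟨(∏ t ∈ T, s t) * y, fun h => ?_, by rwa [mul_right_comm] at h⟩
    rcases hP.mem_or_mem h with h | h
    · obtain ⟨t, ht, h'⟩ := (Ideal.IsPrime.prod_mem_iff (hp := hP)).mp h
      exact hs t ht h'
    · exact hy h

lemma minimal_over_of_height_one {P : Ideal A}
    (hP : P.IsPrime) (h1 : P.height = 1) {x : A} (hx0 : x ≠ 0) (hx : x ∈ P) :
    P ∈ (Ideal.span {x}).minimalPrimes := by
  refine ⟨⟨hP, by rwa [Ideal.span_singleton_le_iff_mem]⟩, ?_⟩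
  rintro Q ⟨hQ, hxQ⟩ hQP
  rw [Ideal.span_singleton_le_iff_mem] at hxQ
  refine (((height_eq_one_iff hP).mp h1).2 Q hQ hQP ?_).ge
  rintro rfl
  exact hx0 (by simpa using hxQ)

/-- A prime element generates a height-one prime, so the prime factors of `y` can be cancelled from
`x` one at a time. -/
lemma dvd_of_forall_height_one_of_ufd [UniqueFactorizationMonoid A] (x y : A) (hy : y ≠ 0)
    (h : ∀ P : Ideal A, P.IsPrime → P.height = 1 → ∃ b ∉ P, y ∣ b * x) : y ∣ x := by
  induction y using UniqueFactorizationMonoid.induction_on_prime generalizing x with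
  | h₁ => exact absurd rfl hy
  | h₂ u hu => exact hu.dvd
  | h₃ y p hy0 hp ih =>
    have hP : (Ideal.span {p}).IsPrime := (Ideal.span_singleton_prime hp.ne_zero).mpr hp
    have hP1 : (Ideal.span {p}).height = 1 := by
      rw [height_eq_one_iff hP]
      refine ⟨by simpa using hp.ne_zero, fun Q hQ hQP hQ0 => le_antisymm hQP ?_⟩
      obtain ⟨q, hqQ, hq⟩ := hQ.exists_mem_prime_of_ne_bot hQ0
      have : Associated p q :=
        hp.associated_of_dvd hq (Ideal.mem_span_singleton.mp (hQP hqQ))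
      rw [Ideal.span_singleton_le_iff_mem]
      exact Q.mem_of_dvd this.symm.dvd hqQ
    obtain ⟨x, rfl⟩ : p ∣ x := by
      obtain ⟨b, hb, h⟩ := h _ hP hP1
      rw [Ideal.mem_span_singleton] at hb
      exact (hp.dvd_or_dvd ((dvd_mul_right p y).trans h)).resolve_left hb
    refine mul_dvd_mul_left p (ih x hy0 fun Q hQ hQ1 => ?_)
    obtain ⟨b, hb, h⟩ := h Q hQ hQ1
    refine ⟨b, hb, ?_⟩
    rw [mul_left_comm] at h
    exact (mul_dvd_mul_iff_left hp.ne_zero).mp h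

/-- A fractional ideal computation: `z ∈ J_v` if and only if `z` is carried into `A` by every
fraction carrying `J` into `A`. -/
lemma mem_vClosure_iff {J : Ideal A} (hJ : J ≠ ⊥) {z : FractionRing A} :
    z ∈ vClosure J ↔ ∀ w : FractionRing A,
      (∀ j ∈ J, ∃ r : A, algebraMap A _ r = w * algebraMap A _ j) →
        ∃ r : A, algebraMap A _ r = z * w := by
  have hJ' : (J : FractionalIdeal A⁰ (FractionRing A)) ≠ 0 := by
    rwa [Ne, FractionalIdeal.coeIdeal_eq_zero]
  have key : ∀ w : FractionRing A, w ∈ ((J : FractionalIdeal A⁰ (FractionRing A))⁻¹) ↔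
      ∀ j ∈ J, ∃ r : A, algebraMap A _ r = w * algebraMap A _ j := by
    intro w
    rw [FractionalIdeal.mem_inv_iff hJ']
    simp only [FractionalIdeal.mem_coeIdeal, FractionalIdeal.mem_one_iff]
    constructor
    · intro h j hj
      exact h _ ⟨j, hj, rfl⟩
    · rintro h _ ⟨j, hj, rfl⟩
      exact h j hj
  have hinv : ((J : FractionalIdeal A⁰ (FractionRing A))⁻¹) ≠ 0 := by
    intro h0
    have h1 : (1 : FractionRing A) ∈ ((J : FractionalIdeal A⁰ (FractionRing A))⁻¹) :=
      (key 1).mpr fun j _ => ⟨j, (one_mul _).symm⟩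
    rw [h0, FractionalIdeal.mem_zero_iff] at h1
    exact one_ne_zero h1
  rw [vClosure, FractionalIdeal.mem_inv_iff hinv]
  simp only [key, FractionalIdeal.mem_one_iff]

lemma vClosure_bot : vClosure (⊥ : Ideal A) = 0 := by
  simp [vClosure, FractionalIdeal.inv_zero']

/-- The fraction `c / a` lies in `J⁻¹` but does not carry `y` into `A`, so `y ∉ J_v`. -/
lemma isTIdeal_of_separating {I : Ideal A}
    (h : ∀ J : Ideal A, J.FG → J ≤ I → ∀ y ∉ I,
      ∃ c a : A, a ≠ 0 ∧ (∀ j ∈ J, a ∣ c * j) ∧ ¬ a ∣ c * y) : IsTIdeal I := by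
  have hinj := IsFractionRing.injective A (FractionRing A)
  ext x
  constructor
  · rintro ⟨J, hJ, hJI, hx⟩
    rcases eq_or_ne J ⊥ with rfl | hJ0
    · rw [vClosure_bot, FractionalIdeal.mem_zero_iff] at hx
      exact ⟨0, I.zero_mem, by simp [hx]⟩
    rw [mem_vClosure_iff hJ0] at hx
    obtain ⟨r, hr⟩ := hx 1 fun j _ => ⟨j, (one_mul _).symm⟩
    rw [mul_one] at hr
    refine ⟨r, ?_, hr⟩
    by_contra hrI
    obtain ⟨c, a, ha, hj, hca⟩ := h J hJ hJI r hrI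
    have ha' : algebraMap A (FractionRing A) a ≠ 0 := by rwa [Ne, map_eq_zero_iff _ hinj]
    obtain ⟨s, hs⟩ := hx (algebraMap A _ c / algebraMap A _ a) fun j hjJ => by
      obtain ⟨t, ht⟩ := hj j hjJ
      refine ⟨t, ?_⟩
      rw [div_mul_eq_mul_div, ← map_mul, ht, map_mul]
      field_simp
    refine hca ⟨s, hinj ?_⟩
    rw [map_mul, map_mul, hs, ← hr]
    field_simp
  · rintro ⟨i, hi, rfl⟩
    refine ⟨Ideal.span {i}, ⟨{i}, by simp⟩, by rwa [Ideal.span_singleton_le_iff_mem], ?_⟩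
    rcases eq_or_ne i 0 with rfl | hi0
    · rw [map_zero]
      exact Submodule.zero_mem (vClosure (Ideal.span {(0 : A)}) : Submodule A (FractionRing A))
    · rw [mem_vClosure_iff (by simpa using hi0)]
      intro w hw
      obtain ⟨r, hr⟩ := hw i (Ideal.mem_span_singleton_self i)
      exact ⟨r, by rw [hr, mul_comm]⟩

lemma isTIdeal_of_height_eq_one {P : Ideal A} (hP : P.IsPrime) (h1 : P.height = 1) :
    IsTIdeal P :=
  isTIdeal_of_separating fun _ hJ hJP _ hy => exists_separating_fraction hP h1 hJ hJP hy

/-- The last hypothesis says `J⁻¹ = A`, whence `1 ∈ J_v ⊆ I_t = I`. -/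
lemma IsTIdeal.eq_top_of_trivial_inverse {I : Ideal A} (hI : IsTIdeal I) {J : Ideal A} (hJ : J.FG)
    (hJI : J ≤ I) (hJ0 : J ≠ ⊥)
    (h : ∀ c a : A, a ≠ 0 → (∀ j ∈ J, a ∣ c * j) → a ∣ c) : I = ⊤ := by
  have hinj := IsFractionRing.injective A (FractionRing A)
  have h1 : (1 : FractionRing A) ∈ tClosure I := by
    refine ⟨J, hJ, hJI, ?_⟩
    rw [mem_vClosure_iff hJ0]
    intro w hw
    obtain ⟨c, a, ha, rfl⟩ := IsFractionRing.div_surjective (A := A) w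
    have ha0 : a ≠ 0 := nonZeroDivisors.ne_zero ha
    have ha' : algebraMap A (FractionRing A) a ≠ 0 := by rwa [Ne, map_eq_zero_iff _ hinj]
    obtain ⟨r, hr⟩ := h c a ha0 fun j hj => by
      obtain ⟨r, hr⟩ := hw j hj
      refine ⟨r, hinj ?_⟩
      rw [map_mul, map_mul, hr]
      field_simp
    refine ⟨r, ?_⟩
    rw [hr, map_mul]
    field_simp
  rw [hI] at h1
  obtain ⟨i, hi, h1⟩ := h1
  rw [Ideal.eq_top_iff_one]
  rwa [← hinj (h1.trans (map_one _).symm)]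

end Domain

/-! ### Homogeneous ideals of the monoid algebra -/

section MonoidAlgebra

variable {D S : Type*} [CommRing D] [AddCancelCommMonoid S]

/-- The homogeneous ideal of `D[S]` of all elements whose coefficient at `s` lies in `N s`. -/
def coeffIdeal (N : S → Ideal D) (hN : ∀ s t, N s ≤ N (t + s)) : Ideal (AddMonoidAlgebra D S) where
  carrier := {f | ∀ s, f.coeff s ∈ N s}
  add_mem' hf hg s := by
    rw [AddMonoidAlgebra.coeff_add, Finsupp.add_apply]
    exact add_mem (hf s) (hg s)
  zero_mem' s := by simp
  smul_mem' g f hf s := by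
    classical
    rw [smul_eq_mul, AddMonoidAlgebra.coeff_mul]
    refine Ideal.sum_mem _ fun a _ => Ideal.sum_mem _ fun b _ => ?_
    dsimp only
    split_ifs with h
    · subst h
      exact Ideal.mul_mem_left _ _ (hN b a (hf b))
    · exact zero_mem _

variable {N P : S → Ideal D} {hN : ∀ s t, N s ≤ N (t + s)} {hP : ∀ s t, P s ≤ P (t + s)}

lemma mem_coeffIdeal {f : AddMonoidAlgebra D S} :
    f ∈ coeffIdeal N hN ↔ ∀ s, f.coeff s ∈ N s := Iff.rfl

lemma single_mem_coeffIdeal {s : S} {a : D} :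
    AddMonoidAlgebra.single s a ∈ coeffIdeal N hN ↔ a ∈ N s := by
  classical
  rw [mem_coeffIdeal]
  constructor
  · intro h
    simpa using h s
  · intro h t
    rw [AddMonoidAlgebra.coeff_single, Finsupp.single_apply]
    split_ifs with hst
    · exact hst ▸ h
    · exact zero_mem _

/-- A homogeneous ideal which is primary as far as monomials are concerned is primary. -/
theorem mem_of_mul_mem_coeffIdeal [UniqueSums S]
    (hrad : ∀ s, ∀ a ∈ P s, ∃ k : ℕ, a ^ k ∈ N (k • s))
    (hcancel : ∀ s t a c, a ∉ P s → a * c ∈ N (s + t) → c ∈ N t)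
    {f g : AddMonoidAlgebra D S} (hf : f ∉ coeffIdeal P hP) (hfg : f * g ∈ coeffIdeal N hN) :
    g ∈ coeffIdeal N hN := by
  classical
  set I : Ideal (AddMonoidAlgebra D S) :=
    Submodule.comap (LinearMap.toSpanSingleton _ (AddMonoidAlgebra D S) g)
      (coeffIdeal N hN) with hI
  have hmem : ∀ h, h ∈ I ↔ h * g ∈ coeffIdeal N hN := fun h => Iff.rfl
  -- `f₀` keeps the terms of `f` witnessing `f ∉ P`. The discarded terms are nilpotent modulo the
  -- colon ideal `I = (N : g)`, so some power of `f₀` still multiplies `g` into `N`.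
  set f₀ : AddMonoidAlgebra D S :=
    .ofCoeff (f.coeff.filter fun s => f.coeff s ∉ P s) with hf₀
  have hf₁ : f - f₀ ∈ coeffIdeal P hP := by
    intro s
    rw [AddMonoidAlgebra.coeff_sub, Finsupp.sub_apply, hf₀, AddMonoidAlgebra.coeff_ofCoeff,
      Finsupp.filter_apply]
    split_ifs with h
    · simpa using h
    · simp
  have hPI : coeffIdeal P hP ≤ I.radical := by
    intro h hh
    rw [← AddMonoidAlgebra.sum_coeff_single h]
    refine Ideal.sum_mem _ fun s _ => ?_
    obtain ⟨k, hk⟩ := hrad s _ (hh s)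
    refine ⟨k, ?_⟩
    rw [AddMonoidAlgebra.single_pow, hmem]
    exact Ideal.mul_mem_right _ _ (single_mem_coeffIdeal.mpr hk)
  obtain ⟨k, hk⟩ : f₀ ∈ I.radical := by
    have := I.radical.sub_mem (Ideal.le_radical ((hmem f).mpr hfg)) (hPI hf₁)
    rwa [sub_sub_cancel] at this
  rw [hmem] at hk
  -- Drop from `h` the terms already in `N`. At a uniquely represented sum of exponents the
  -- coefficient of `f₀ * h₀` is a single product, to which `hcancel` applies.
  have cancel : ∀ h, f₀ * h ∈ coeffIdeal N hN → h ∈ coeffIdeal N hN := by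
    intro h hh
    by_contra hn
    set h₀ : AddMonoidAlgebra D S :=
      .ofCoeff (h.coeff.filter fun s => h.coeff s ∉ N s) with hh₀
    have hsub : h - h₀ ∈ coeffIdeal N hN := by
      intro s
      rw [AddMonoidAlgebra.coeff_sub, Finsupp.sub_apply, hh₀, AddMonoidAlgebra.coeff_ofCoeff,
        Finsupp.filter_apply]
      split_ifs with h
      · simpa using h
      · simp
    have hmul : f₀ * h₀ ∈ coeffIdeal N hN := by
      have := Ideal.sub_mem _ hh (Ideal.mul_mem_left _ f₀ hsub)
      rwa [← mul_sub, sub_sub_cancel] at this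
    have hne₁ : f₀.coeff.support.Nonempty := by
      rw [Finsupp.support_nonempty_iff]
      intro h0
      have : f₀ = 0 := by simpa using h0
      rw [this, sub_zero] at hf₁
      exact hf hf₁
    have hne₂ : h₀.coeff.support.Nonempty := by
      rw [Finsupp.support_nonempty_iff]
      intro h0
      have : h₀ = 0 := by simpa using h0
      rw [this, sub_zero] at hsub
      exact hn hsub
    obtain ⟨s, hs, t, ht, hu⟩ := UniqueSums.uniqueAdd_of_nonempty hne₁ hne₂
    have hst := hmul (s + t)
    rw [AddMonoidAlgebra.coeff_mul_add_of_uniqueAdd hu] at hst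
    rw [hf₀, AddMonoidAlgebra.coeff_ofCoeff, Finsupp.support_filter, Finset.mem_filter] at hs
    rw [hh₀, AddMonoidAlgebra.coeff_ofCoeff, Finsupp.support_filter, Finset.mem_filter] at ht
    rw [hf₀, hh₀, AddMonoidAlgebra.coeff_ofCoeff, AddMonoidAlgebra.coeff_ofCoeff,
      Finsupp.filter_apply_pos (fun s => f.coeff s ∉ P s) _ hs.2,
      Finsupp.filter_apply_pos (fun s => h.coeff s ∉ N s) _ ht.2] at hst
    exact ht.2 (hcancel s t _ _ hs.2 hst)
  clear_value f₀
  induction k with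
  | zero => simpa using hk
  | succ k ih =>
    refine ih (cancel _ ?_)
    rwa [← mul_assoc, ← pow_succ']

lemma coeffIdeal_isPrime [UniqueSums S] (hcancel : ∀ s t a c, a ∉ P s → a * c ∈ P (s + t) → c ∈ P t)
    (h0 : P 0 ≠ ⊤) : (coeffIdeal P hP).IsPrime := by
  refine ⟨?_, fun {f g} h => or_iff_not_imp_left.mpr fun hf =>
    mem_of_mul_mem_coeffIdeal (fun s a ha => ⟨1, by simpa using ha⟩) hcancel hf h⟩
  rw [Ne, Ideal.eq_top_iff_one, AddMonoidAlgebra.one_def, single_mem_coeffIdeal,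
    ← Ideal.eq_top_iff_one]
  exact h0

variable (S) in
/-- The extension `I[S]` of an ideal `I` of `D`. -/
def extIdeal (I : Ideal D) : Ideal (AddMonoidAlgebra D S) :=
  coeffIdeal (fun _ => I) fun _ _ => le_rfl

lemma mem_extIdeal {I : Ideal D} {f : AddMonoidAlgebra D S} :
    f ∈ extIdeal S I ↔ ∀ s, f.coeff s ∈ I := Iff.rfl

lemma extIdeal_isPrime [UniqueSums S] {I : Ideal D} (hI : I.IsPrime) : (extIdeal S I).IsPrime :=
  coeffIdeal_isPrime (fun _ _ _ _ ha h => (hI.mem_or_mem h).resolve_left ha) hI.ne_top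

lemma algebraMap_mem_extIdeal {I : Ideal D} {a : D} :
    algebraMap D (AddMonoidAlgebra D S) a ∈ extIdeal S I ↔ a ∈ I :=
  single_mem_coeffIdeal

lemma comap_extIdeal {p : Ideal D} : (extIdeal S p).comap (algebraMap D _) = p :=
  Ideal.ext fun _ => algebraMap_mem_extIdeal

lemma extIdeal_ne_bot {p : Ideal D} (hp : p ≠ ⊥) : extIdeal S p ≠ ⊥ := by
  intro h
  apply hp
  rw [← comap_extIdeal (S := S) (p := p), h]
  rw [eq_bot_iff]
  intro d hd
  rw [Ideal.mem_comap, Ideal.mem_bot, AddMonoidAlgebra.coe_algebraMap, Function.comp_apply,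
    AddMonoidAlgebra.single_eq_zero] at hd
  exact hd

lemma extIdeal_le_of_forall_algebraMap_mem {I : Ideal D} {Q : Ideal (AddMonoidAlgebra D S)}
    (h : ∀ a ∈ I, algebraMap D _ a ∈ Q) : extIdeal S I ≤ Q := by
  intro f hf
  rw [← AddMonoidAlgebra.sum_coeff_single f]
  refine Ideal.sum_mem _ fun s _ => ?_
  have : AddMonoidAlgebra.single s (f.coeff s) =
      AddMonoidAlgebra.single s 1 * algebraMap D (AddMonoidAlgebra D S) (f.coeff s) := by
    simp [AddMonoidAlgebra.single_mul_single]
  rw [this]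
  exact Ideal.mul_mem_left _ _ (h _ (hf s))

lemma algebraMap_dvd_iff {d : D} {f : AddMonoidAlgebra D S} :
    algebraMap D _ d ∣ f ↔ ∀ s, d ∣ f.coeff s := by
  constructor
  · rintro ⟨g, rfl⟩ s
    rw [AddMonoidAlgebra.coe_algebraMap, Function.comp_apply,
      AddMonoidAlgebra.coeff_single_zero_mul]
    exact dvd_mul_right _ _
  · intro h
    have : f ∈ extIdeal S (Ideal.span {d}) := fun s => Ideal.mem_span_singleton.mpr (h s)
    rw [← Ideal.mem_span_singleton]
    refine extIdeal_le_of_forall_algebraMap_mem (fun a ha => ?_) this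
    rw [Ideal.mem_span_singleton] at ha ⊢
    exact map_dvd _ ha

lemma single_one_dvd_iff {t : S} {f : AddMonoidAlgebra D S} :
    AddMonoidAlgebra.single t 1 ∣ f ↔ ∀ s ∈ f.coeff.support, ∃ u, s = t + u := by
  classical
  constructor
  · rintro ⟨g, rfl⟩ s hs
    by_contra! h
    rw [Finsupp.mem_support_iff,
      AddMonoidAlgebra.coeff_single_mul_of_forall_add_ne _ _ fun u hu => h u hu.symm] at hs
    exact hs rfl
  · intro h
    rw [← AddMonoidAlgebra.sum_coeff_single f]
    refine Finset.dvd_sum fun s hs => ?_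
    obtain ⟨u, rfl⟩ := h s hs
    exact ⟨AddMonoidAlgebra.single u (f.coeff (t + u)), by
      simp [AddMonoidAlgebra.single_mul_single]⟩

open Classical in
variable (D) in
/-- The homogeneous ideal `D[P]` of `D[S]` spanned by the monomials with exponent in an ideal `P`
of `S`. -/
noncomputable def monIdeal (P : Set S) (hP : ∀ s, ∀ p ∈ P, s + p ∈ P) : Ideal (AddMonoidAlgebra D S) :=
  coeffIdeal (fun s => if s ∈ P then ⊤ else ⊥) fun s t => by
    split_ifs with h h'
    · exact le_rfl
    · exact absurd (hP t s h) h'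
    · exact bot_le
    · exact le_rfl

lemma mem_monIdeal {P : Set S} {hP : ∀ s, ∀ p ∈ P, s + p ∈ P} {f : AddMonoidAlgebra D S} :
    f ∈ monIdeal D P hP ↔ ∀ s ∈ f.coeff.support, s ∈ P := by
  rw [monIdeal, mem_coeffIdeal]
  refine forall_congr' fun s => ?_
  rw [Finsupp.mem_support_iff]
  split_ifs with h <;> simp [h]

lemma single_one_mem_monIdeal [Nontrivial D] {P : Set S} {hP : ∀ s, ∀ p ∈ P, s + p ∈ P} {s : S} :
    AddMonoidAlgebra.single s 1 ∈ monIdeal D P hP ↔ s ∈ P := by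
  rw [monIdeal, single_mem_coeffIdeal]
  split_ifs with h <;> simp [h]

/-- `mem_of_mul_mem_coeffIdeal` for families with values `⊤` and `⊥`: it transfers "`N` is
`P`-primary" from `S` to `D[S]`. -/
lemma mem_monIdeal_of_mul_mem [IsDomain D] [UniqueSums S] {P N : Set S}
    {hP : ∀ s, ∀ p ∈ P, s + p ∈ P} {hN : ∀ s, ∀ p ∈ N, s + p ∈ N}
    (hrad : ∀ s ∈ P, ∃ k : ℕ, k • s ∈ N) (hcancel : ∀ s t, s ∉ P → s + t ∈ N → t ∈ N)
    {f g : AddMonoidAlgebra D S} (hf : f ∉ monIdeal D P hP) (hfg : f * g ∈ monIdeal D N hN) :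
    g ∈ monIdeal D N hN := by
  refine mem_of_mul_mem_coeffIdeal (fun s a ha => ?_) (fun s t a c ha hac => ?_) hf hfg
  · split_ifs at ha with hs
    · obtain ⟨k, hk⟩ := hrad s hs
      exact ⟨k, by simp [hk]⟩
    · refine ⟨1, ?_⟩
      rw [Ideal.mem_bot] at ha
      simp [ha]
  · by_cases ht : t ∈ N
    · simp [ht]
    · have ha0 : a ≠ 0 := by
        rintro rfl
        exact ha (zero_mem _)
      have hs : s ∉ P := by
        intro hs
        simp [hs] at ha
      rw [if_neg fun h => ht (hcancel s t hs h), Ideal.mem_bot] at hac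
      rw [(mul_eq_zero.mp hac).resolve_left ha0]
      exact zero_mem _

lemma monIdeal_isPrime [IsDomain D] [UniqueSums S] {P : Set S} (hP : IsPrimeIdeal P) :
    (monIdeal D P fun s _ => hP.add_mem s).IsPrime := by
  refine ⟨?_, fun {f g} h => or_iff_not_imp_left.mpr fun hf =>
    mem_monIdeal_of_mul_mem (fun s hs => ⟨1, by simpa using hs⟩)
      (fun s t hs h => (hP.mem_or_mem h).resolve_left hs) hf h⟩
  rw [Ne, Ideal.eq_top_iff_one, AddMonoidAlgebra.one_def, single_one_mem_monIdeal]
  intro h0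
  exact hP.ne_univ (Set.eq_univ_of_forall fun s => by simpa using hP.add_mem s h0)

lemma monIdeal_le_of_forall_single_mem {P : Set S} {hP : ∀ s, ∀ p ∈ P, s + p ∈ P}
    {Q : Ideal (AddMonoidAlgebra D S)} (h : ∀ s ∈ P, AddMonoidAlgebra.single s 1 ∈ Q) :
    monIdeal D P hP ≤ Q := by
  intro f hf
  rw [← AddMonoidAlgebra.sum_coeff_single f]
  refine Ideal.sum_mem _ fun s hs => ?_
  have : AddMonoidAlgebra.single s (f.coeff s) =
      algebraMap D (AddMonoidAlgebra D S) (f.coeff s) * AddMonoidAlgebra.single s 1 := by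
    simp [AddMonoidAlgebra.single_mul_single]
  rw [this]
  exact Ideal.mul_mem_left _ _ (h _ (mem_monIdeal.mp hf s hs))

/-- The exponents of the monomials in a prime ideal of `D[S]` form a prime ideal of `S`. -/
lemma isPrimeIdeal_setOf_single_mem {Q : Ideal (AddMonoidAlgebra D S)} (hQ : Q.IsPrime) :
    IsPrimeIdeal {s : S | AddMonoidAlgebra.single s 1 ∈ Q} where
  add_mem s p hp := by
    have := Q.mul_mem_left (AddMonoidAlgebra.single s 1) hp
    rwa [AddMonoidAlgebra.single_mul_single, mul_one] at this
  ne_univ h := by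
    have : (0 : S) ∈ {s : S | AddMonoidAlgebra.single s 1 ∈ Q} := h ▸ Set.mem_univ _
    exact hQ.one_notMem this
  mem_or_mem {a b} h := by
    apply hQ.mem_or_mem
    rw [AddMonoidAlgebra.single_mul_single, mul_one]
    exact h

end MonoidAlgebra

/-! ### Localizations of monoid algebras at monomials -/

section Localization

variable {D D' S T : Type*} [CommRing D] [CommRing D'] [Algebra D D']
  [AddCancelCommMonoid S] [AddCancelCommMonoid T]

variable (D D') in
/-- The ring homomorphism `D[S] → D'[T]` induced by `D → D'` and `S → T`. -/
noncomputable def monoidAlgebraMap (φ : S →+ T) : AddMonoidAlgebra D S →+* AddMonoidAlgebra D' T :=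
  (AddMonoidAlgebra.mapDomainRingHom D' φ).comp
    (AddMonoidAlgebra.mapRingHom S (algebraMap D D'))

@[simp]
lemma monoidAlgebraMap_single (φ : S →+ T) (s : S) (d : D) :
    monoidAlgebraMap D D' φ (AddMonoidAlgebra.single s d) =
      AddMonoidAlgebra.single (φ s) (algebraMap D D' d) := by
  simp [monoidAlgebraMap]

lemma monoidAlgebraMap_injective (hD : Function.Injective (algebraMap D D')) {φ : S →+ T}
    (hφ : Function.Injective φ) : Function.Injective (monoidAlgebraMap D D' φ) :=
  (AddMonoidAlgebra.mapDomain_injective hφ).comp (AddMonoidAlgebra.map_injective _ hD)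

lemma coeff_monoidAlgebraMap {φ : S →+ T} (hφ : Function.Injective φ) (f : AddMonoidAlgebra D S)
    (s : S) : (monoidAlgebraMap D D' φ f).coeff (φ s) = algebraMap D D' (f.coeff s) := by
  have : (monoidAlgebraMap D D' φ f).coeff =
      Finsupp.mapDomain φ (AddMonoidAlgebra.mapRingHom S (algebraMap D D') f).coeff := rfl
  rw [this, Finsupp.mapDomain_apply hφ]
  simp

/-- The monomials of `D[S]` with coefficient in `M` and exponent in `F`. -/
def monomials (M : Submonoid D) (F : AddSubmonoid S) : Submonoid (AddMonoidAlgebra D S) where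
  carrier := {x | ∃ d ∈ M, ∃ s ∈ F, x = AddMonoidAlgebra.single s d}
  mul_mem' := by
    rintro _ _ ⟨d, hd, s, hs, rfl⟩ ⟨d', hd', s', hs', rfl⟩
    exact ⟨d * d', mul_mem hd hd', s + s', add_mem hs hs', AddMonoidAlgebra.single_mul_single ..⟩
  one_mem' := ⟨1, one_mem _, 0, zero_mem _, rfl⟩

/-- Monomials acquire a denominator coefficient by coefficient and exponent by exponent, and finite
sums acquire a common one. Covers `K[S]`, `K[G]` and the passage from a free monoid to its group. -/
theorem isLocalization_monoidAlgebraMap {M : Submonoid D} [IsLocalization M D']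
    (hD : Function.Injective (algebraMap D D')) {F : AddSubmonoid S} {φ : S →+ T}
    (hφ : Function.Injective φ) (hunit : ∀ s ∈ F, IsAddUnit (φ s))
    (hsurj : ∀ t, ∃ s ∈ F, ∃ u, t + φ s = φ u) :
    @IsLocalization _ _ (monomials M F) (AddMonoidAlgebra D' T) _
      (monoidAlgebraMap D D' φ).toAlgebra := by
  let := (monoidAlgebraMap D D' φ).toAlgebra
  have hmap : algebraMap (AddMonoidAlgebra D S) (AddMonoidAlgebra D' T) =
    monoidAlgebraMap D D' φ := rfl
  rw [isLocalization_iff]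
  refine ⟨?_, ?_, ?_⟩
  · rintro ⟨_, d, hd, s, hs, rfl⟩
    obtain ⟨u, hu⟩ := IsLocalization.map_units D' ⟨d, hd⟩
    obtain ⟨v, hv⟩ := hunit s hs
    rw [hmap, monoidAlgebraMap_single]
    refine IsUnit.of_mul_eq_one (AddMonoidAlgebra.single (↑(-v) : T) (↑u⁻¹ : D')) ?_
    rw [AddMonoidAlgebra.single_mul_single, ← hv, ← hu, AddUnits.add_neg, Units.mul_inv]
    rfl
  · intro z
    induction z using AddMonoidAlgebra.induction_linear with
    | zero => exact ⟨(0, 1), by simp⟩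
    | add x y hx hy =>
      obtain ⟨⟨a, v⟩, ha⟩ := hx
      obtain ⟨⟨b, w⟩, hb⟩ := hy
      refine ⟨(a * w + b * v, v * w), ?_⟩
      simp only [Submonoid.coe_mul, map_mul, map_add] at ha hb ⊢
      rw [← ha, ← hb]
      ring
    | single t c =>
      obtain ⟨⟨d, m⟩, hd⟩ := IsLocalization.surj M c
      obtain ⟨s, hs, u, hu⟩ := hsurj t
      refine ⟨(AddMonoidAlgebra.single u d, ⟨_, m, m.2, s, hs, rfl⟩), ?_⟩
      simp only [hmap, monoidAlgebraMap_single, AddMonoidAlgebra.single_mul_single, hu, hd]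
  · intro x y h
    exact ⟨1, by rw [monoidAlgebraMap_injective hD hφ h]⟩

end Localization

/-! ### Height-one primes through the Noetherian ring `K[S]` -/

section FieldCoefficients

variable {D S : Type*} [CommRing D] [AddCancelCommMonoid S]

/-- `K[S]` is the localization of `D[S]` at the non-zero constants. -/
lemma isLocalization_fractionRing (D S : Type*) [CommRing D] [IsDomain D] [AddCancelCommMonoid S] :
    @IsLocalization _ _ (monomials D⁰ (⊥ : AddSubmonoid S))
      (AddMonoidAlgebra (FractionRing D) S) _
      (monoidAlgebraMap D (FractionRing D) (AddMonoidHom.id S)).toAlgebra :=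
  isLocalization_monoidAlgebraMap (IsFractionRing.injective D _) Function.injective_id
    (fun s hs => by rw [AddSubmonoid.mem_bot] at hs; simp [hs])
    fun t => ⟨0, zero_mem _, t, by simp⟩

lemma disjoint_monomials_bot [IsDomain D] {Q : Ideal (AddMonoidAlgebra D S)}
    (hQD : Q.comap (algebraMap D _) = ⊥) :
    Disjoint (monomials D⁰ (⊥ : AddSubmonoid S) : Set (AddMonoidAlgebra D S)) Q := by
  rw [Set.disjoint_left]
  rintro _ ⟨d, hd, s, hs, rfl⟩ hdQ
  rw [AddSubmonoid.mem_bot] at hs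
  subst hs
  have : d ∈ Q.comap (algebraMap D _) := hdQ
  rw [hQD, Ideal.mem_bot] at this
  exact nonZeroDivisors.ne_zero hd this

lemma monIdeal_ne_bot [Nontrivial D] {P : Set S} {hP : ∀ s, ∀ p ∈ P, s + p ∈ P}
    (hne : P.Nonempty) : monIdeal D P hP ≠ ⊥ := by
  obtain ⟨s, hs⟩ := hne
  intro h
  have := single_one_mem_monIdeal (D := D) (hP := hP).mpr hs
  rw [h, Ideal.mem_bot, AddMonoidAlgebra.single_eq_zero] at this
  exact one_ne_zero this

variable [IsDomain D] [UniqueSums S]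

/-- A non-zero element of `D[S]` lies in only finitely many height-one primes that intersect `D`
trivially. -/
lemma finite_height_one_of_comap_eq_bot [AddMonoid.FG S] {f : AddMonoidAlgebra D S} (hf : f ≠ 0) :
    {Q : Ideal (AddMonoidAlgebra D S) | (Q.IsPrime ∧ Q.height = 1 ∧ f ∈ Q) ∧
      Q.comap (algebraMap D _) = ⊥}.Finite := by
  let := (monoidAlgebraMap D (FractionRing D) (AddMonoidHom.id S)).toAlgebra
  have hloc := isLocalization_fractionRing D S
  have hinj : Function.Injective (algebraMap (AddMonoidAlgebra D S)
      (AddMonoidAlgebra (FractionRing D) S)) :=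
    monoidAlgebraMap_injective (IsFractionRing.injective D _) Function.injective_id
  have : IsNoetherianRing (AddMonoidAlgebra (FractionRing D) S) :=
    Algebra.FiniteType.isNoetherianRing (FractionRing D) _
  have hunder : ∀ Q ∈ {Q : Ideal (AddMonoidAlgebra D S) | (Q.IsPrime ∧ Q.height = 1 ∧ f ∈ Q) ∧
      Q.comap (algebraMap D _) = ⊥}, (Q.map (algebraMap (AddMonoidAlgebra D S)
        (AddMonoidAlgebra (FractionRing D) S))).under _ = Q := by
    rintro Q ⟨⟨hQ, -, -⟩, hQD⟩
    exact IsLocalization.under_map_of_isPrime_disjoint _ _ hQ (disjoint_monomials_bot hQD)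
  refine Set.Finite.of_finite_image (f := Ideal.map (algebraMap (AddMonoidAlgebra D S)
    (AddMonoidAlgebra (FractionRing D) S))) ?_ fun Q hQ Q' hQ' h => ?_
  -- These primes survive in `K[S]` with height one, so they become minimal over `f`, and a
  -- Noetherian ring has finitely many such primes.
  · refine (Ideal.finite_minimalPrimes_of_isNoetherianRing _ (Ideal.span
      {algebraMap (AddMonoidAlgebra D S) (AddMonoidAlgebra (FractionRing D) S) f})).subset ?_
    rintro _ ⟨Q, hQ', rfl⟩
    have hu := hunder Q hQ'
    obtain ⟨⟨hQ, hQ1, hfQ⟩, hQD⟩ := hQ'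
    refine minimal_over_of_height_one
      (IsLocalization.isPrime_of_isPrime_disjoint _ _ _ hQ (disjoint_monomials_bot hQD)) ?_
      (by rwa [Ne, map_eq_zero_iff _ hinj]) (Ideal.mem_map_of_mem _ hfQ)
    rw [← IsLocalization.height_under (monomials D⁰ (⊥ : AddSubmonoid S)), hu, hQ1]
  · rw [← hunder Q hQ, h, hunder Q' hQ']

/-- Krull's principal ideal theorem: for `s ∈ P`, the ideal `K[P]` is minimal over the monomial
`X^s`, because the exponents of the monomials in a smaller prime containing `X^s` form a non-empty
prime of `S` inside the minimal `P`. -/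
lemma monIdeal_height_eq_one_of_field {K : Type*} [Field K] [AddMonoid.FG S] {P : Set S}
    (hP : P ∈ minimalPrimeIdeals S) :
    (monIdeal K P fun s _ => hP.1.2.add_mem s).height = 1 := by
  have : IsNoetherianRing (AddMonoidAlgebra K S) := Algebra.FiniteType.isNoetherianRing K _
  have hprime := monIdeal_isPrime (D := K) hP.1.2
  apply le_antisymm
  · obtain ⟨s, hs⟩ := hP.1.1
    refine Ideal.height_le_one_of_isPrincipal_of_mem_minimalPrimes
      (Ideal.span {AddMonoidAlgebra.single s (1 : K)}) _ ⟨⟨hprime, ?_⟩, ?_⟩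
    · rw [Ideal.span_singleton_le_iff_mem]
      exact single_one_mem_monIdeal.mpr hs
    · rintro Q ⟨hQ, hsQ⟩ hQP
      rw [Ideal.span_singleton_le_iff_mem] at hsQ
      refine monIdeal_le_of_forall_single_mem fun t ht => ?_
      refine hP.2 (y := {s : S | AddMonoidAlgebra.single s 1 ∈ Q})
        ⟨⟨s, hsQ⟩, isPrimeIdeal_setOf_single_mem hQ⟩ (fun u hu => ?_) ht
      exact single_one_mem_monIdeal.mp (hQP hu)
  · rw [Order.one_le_iff_ne_zero, Ne, Ideal.height_eq_zero_iff_eq_bot]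
    exact monIdeal_ne_bot hP.1.1

lemma monIdeal_height_eq_one [AddMonoid.FG S] {P : Set S} (hP : P ∈ minimalPrimeIdeals S) :
    (monIdeal D P fun s _ => hP.1.2.add_mem s).height = 1 := by
  let := (monoidAlgebraMap D (FractionRing D) (AddMonoidHom.id S)).toAlgebra
  have hloc := isLocalization_fractionRing D S
  rw [← monIdeal_height_eq_one_of_field (K := FractionRing D) hP,
    ← IsLocalization.height_under (A := AddMonoidAlgebra (FractionRing D) S)
      (monomials D⁰ (⊥ : AddSubmonoid S))]
  congr 1
  ext f
  rw [Ideal.under, Ideal.mem_comap, mem_monIdeal, mem_monIdeal]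
  refine forall_congr' fun s => ?_
  have : (algebraMap (AddMonoidAlgebra D S) (AddMonoidAlgebra (FractionRing D) S) f).coeff s =
      algebraMap D _ (f.coeff s) :=
    coeff_monoidAlgebraMap (φ := AddMonoidHom.id S) Function.injective_id f s
  rw [Finsupp.mem_support_iff, Finsupp.mem_support_iff, this, Ne,
    Ne, map_eq_zero_iff _ (IsFractionRing.injective D (FractionRing D))]

end FieldCoefficients

/-! ### Factoriality of `K[ℤⁿ]` -/

section GroupAlgebra

lemma uniqueFactorizationMonoid_of_isLocalization {R L : Type*} [CommRing R] [CommRing L]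
    (f : R →+* L) (M : Submonoid R) (h : @IsLocalization _ _ M L _ f.toAlgebra)
    (hR : UniqueFactorizationMonoid R) : UniqueFactorizationMonoid L := by
  let := f.toAlgebra
  exact UniqueFactorizationMonoid.of_isLocalization M L

lemma uniqueFactorizationMonoid_of_addEquiv (K : Type*) [Field K] {T ι : Type*}
    [AddCancelCommMonoid T] (e : (ι →₀ ℕ) ≃+ T) :
    UniqueFactorizationMonoid (AddMonoidAlgebra K T) :=
  (AddMonoidAlgebra.domCongr K K e).toMulEquiv.uniqueFactorizationMonoid
    (inferInstanceAs (UniqueFactorizationMonoid (MvPolynomial ι K)))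

lemma uniqueFactorizationMonoid_of_addMonoid_localization (K : Type*) {T ι G : Type*} [Field K]
    [AddCancelCommMonoid T] [AddCommGroup G] (e : (ι →₀ ℕ) ≃+ T) (φ : T →+ G)
    (hφ : Function.Injective φ) (hsurj : ∀ t, ∃ s u, t + φ s = φ u) :
    UniqueFactorizationMonoid (AddMonoidAlgebra K G) := by
  have : IsLocalization (⊥ : Submonoid K) K := IsLocalization.self bot_le
  refine uniqueFactorizationMonoid_of_isLocalization (monoidAlgebraMap K K φ)
    (monomials (⊥ : Submonoid K) (⊤ : AddSubmonoid T)) ?_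
    (uniqueFactorizationMonoid_of_addEquiv K e)
  refine isLocalization_monoidAlgebraMap
    Function.injective_id hφ (fun s _ => AddGroup.isAddUnit _) fun t => ?_
  obtain ⟨s, u, h⟩ := hsurj t
  exact ⟨s, trivial, u, h⟩

/-- Embed `ℕⁿ` in `ℤⁿ ≃ G`; every integer is its positive part minus its negative part. Thus `K[G]`
is a localization of a polynomial ring. -/
lemma exists_free_addMonoid_embedding (G : Type*) [AddCommGroup G]
    [Module.Free ℤ G] [Module.Finite ℤ G] :
    ∃ (n : ℕ) (φ : (Fin n → ℕ) →+ G), Function.Injective φ ∧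
      ∀ t, ∃ s u, t + φ s = φ u := by
  let b := Module.finBasis ℤ G
  let e : (Fin _ → ℤ) ≃+ G := b.equivFun.symm.toAddEquiv
  refine ⟨Module.finrank ℤ G, e.toAddMonoidHom.comp ((Nat.castAddMonoidHom ℤ).compLeft _),
    e.injective.comp fun x y h => funext fun i => Nat.cast_injective (R := ℤ) (congrFun h i),
    fun t => ?_⟩
  refine ⟨fun i => (-(e.symm t i)).toNat, fun i => (e.symm t i).toNat, ?_⟩
  obtain ⟨x, rfl⟩ := e.surjective t
  rw [AddEquiv.symm_apply_apply]
  refine (map_add e _ _).symm.trans (congrArg e (funext fun i => ?_))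
  change x i + ((-(x i)).toNat : ℤ) = ((x i).toNat : ℤ)
  omega

/-- The group algebra of a free abelian group of finite rank over a field is factorial. -/
lemma uniqueFactorizationMonoid_addMonoidAlgebra (K G : Type*) [Field K] [AddCommGroup G]
    [Module.Free ℤ G] [Module.Finite ℤ G] :
    UniqueFactorizationMonoid (AddMonoidAlgebra K G) := by
  obtain ⟨n, φ, hφ, hsurj⟩ := exists_free_addMonoid_embedding G
  exact uniqueFactorizationMonoid_of_addMonoid_localization K
    (Finsupp.linearEquivFunOnFinite ℕ ℕ (Fin n)).toAddEquiv φ hφ hsurj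

end GroupAlgebra

/-! ### From a prime inside `p[S]` to an upper to zero inside `p[X]` -/

section Valuation

/-- A prime containing the kernel of a map into a field `L` is the center of a valuation ring
of `L`. -/
lemma exists_valuationSubring_center {B L : Type*} [CommRing B] [Field L] (f : B →+* L)
    {M : Ideal B} (hM : M.IsPrime) (hker : RingHom.ker f ≤ M) :
    ∃ (W : ValuationSubring L) (g : B →+* W), (∀ b, (g b : L) = f b) ∧
      ∀ b, IsLocalRing.residue W (g b) = 0 ↔ b ∈ M := by
  have hne : ∀ b ∉ M, f b ≠ 0 := fun b hb h => hb (hker h)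
  let loc : Localization.AtPrime M →+* L :=
    IsLocalization.lift (M := M.primeCompl) (g := f) fun b => (hne b b.2).isUnit
  have hloc : ∀ b, loc (algebraMap _ _ b) = f b := fun b => IsLocalization.lift_eq _ b
  -- The maximal ideal of `B_M` has proper image: if `b / s` with `b ∈ M` mapped to `1`, then `s -
  -- b` would lie in the kernel, hence in `M`, forcing `s ∈ M`.
  obtain ⟨W, hW, hnon⟩ := Ideal.image_subset_nonunits_valuationSubring (A := loc.range)
    ((IsLocalRing.maximalIdeal (Localization.AtPrime M)).map loc.rangeRestrict) <| by
      rw [Ne, Ideal.eq_top_iff_one,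
        Ideal.mem_map_iff_of_surjective _ loc.rangeRestrict_surjective]
      rintro ⟨y, hy, hy1⟩
      obtain ⟨b, s, rfl⟩ := IsLocalization.exists_mk'_eq M.primeCompl y
      have hbM : b ∈ M := by
        by_contra hb
        exact (IsLocalRing.mem_maximalIdeal _).mp hy
          ((IsLocalization.AtPrime.isUnit_mk'_iff (Localization.AtPrime M) M b s).mpr hb)
      have h1 : loc (IsLocalization.mk' _ b s) = 1 := congrArg Subtype.val hy1
      have h2 : f b = f s := by
        rw [← hloc, ← hloc, ← IsLocalization.mk'_spec (Localization.AtPrime M) b s, map_mul, h1,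
          one_mul]
      have h3 : (s : B) - b ∈ M := hker (by rw [RingHom.mem_ker, map_sub, h2, sub_self])
      exact s.2 (by simpa using M.add_mem h3 hbM)
  have hfW : ∀ b, f b ∈ W := fun b => hW ⟨_, hloc b⟩
  refine ⟨W, f.codRestrict W.toSubring hfW, fun b => rfl, fun b => ?_⟩
  rw [IsLocalRing.residue_eq_zero_iff, IsLocalRing.mem_maximalIdeal, mem_nonunits_iff]
  constructor
  · intro h
    by_contra hb
    refine h (IsUnit.of_mul_eq_one ⟨(f b)⁻¹, hW ⟨IsLocalization.mk' _ 1 (⟨b, hb⟩ : M.primeCompl), ?_⟩⟩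
      (Subtype.ext (mul_inv_cancel₀ (hne b hb))))
    rw [eq_comm, inv_eq_of_mul_eq_one_left]
    rw [← hloc, ← map_mul, mul_comm, IsLocalization.mk'_spec' (Localization.AtPrime M) 1
      (⟨b, hb⟩ : M.primeCompl), map_one, map_one]
  · intro hb hu
    have : f b ∈ W.nonunits := hnon ⟨_, Ideal.mem_map_of_mem loc.rangeRestrict
      ((IsLocalization.AtPrime.to_map_mem_maximal_iff (Localization.AtPrime M) M b).mpr hb),
      hloc b⟩
    rw [ValuationSubring.mem_nonunits_iff_or] at this
    obtain ⟨c, hc⟩ := hu.exists_right_inv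
    have hc' : f b * c = 1 := congrArg Subtype.val hc
    rcases this with h0 | h0
    · rw [h0, zero_mul] at hc'
      exact zero_ne_one hc'
    · exact h0 (by rw [inv_eq_of_mul_eq_one_right hc']; exact c.2)

/-- Linear independence of monomials over a field persists over an algebraic extension. -/
lemma lift_integralClosure_injective {κ k S : Type*} [Field κ] [Field k] [Algebra κ k]
    [AddCancelCommMonoid S] [UniqueSums S] (F : Multiplicative S →* k)
    (hF : Function.Injective (AddMonoidAlgebra.lift κ k S F)) :
    Function.Injective (AddMonoidAlgebra.lift (integralClosure κ k) k S F) := by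
  let incl : AddMonoidAlgebra κ S →+* AddMonoidAlgebra (integralClosure κ k) S :=
    AddMonoidAlgebra.mapRingHom S (algebraMap κ (integralClosure κ k))
  let := incl.toAlgebra
  have hincl : ∀ x, AddMonoidAlgebra.lift (integralClosure κ k) k S F (incl x) =
      AddMonoidAlgebra.lift κ k S F x := by
    intro x
    induction x using AddMonoidAlgebra.induction_linear with
    | zero => simp
    | add x y hx hy => simp only [map_add, hx, hy]
    | single s c =>
      simp only [incl, AddMonoidAlgebra.mapRingHom_single, AddMonoidAlgebra.lift_single]
      exact algebraMap_smul _ _ _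
  have hint : Algebra.IsIntegral (AddMonoidAlgebra κ S)
      (AddMonoidAlgebra (integralClosure κ k) S) := by
    refine ⟨fun x => ?_⟩
    induction x using AddMonoidAlgebra.induction_linear with
    | zero => exact isIntegral_zero
    | add x y hx hy => exact hx.add hy
    | single s c =>
      have h1 : IsIntegral (AddMonoidAlgebra κ S)
          (AddMonoidAlgebra.single (0 : S) c : AddMonoidAlgebra (integralClosure κ k) S) := by
        obtain ⟨h, hm, he⟩ := (integralClosure.isIntegral c : IsIntegral κ c)
        refine ⟨h.map (AddMonoidAlgebra.singleZeroRingHom (M := S)), hm.map _, ?_⟩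
        rw [Polynomial.eval₂_map]
        have : (algebraMap (AddMonoidAlgebra κ S) (AddMonoidAlgebra (integralClosure κ k) S)).comp
            (AddMonoidAlgebra.singleZeroRingHom (M := S)) =
            (AddMonoidAlgebra.singleZeroRingHom (M := S)).comp (algebraMap κ (integralClosure κ k)) := by
          refine RingHom.ext fun a => ?_
          exact AddMonoidAlgebra.mapRingHom_single (algebraMap κ (integralClosure κ k)) (0 : S) a
        rw [this]
        have := Polynomial.hom_eval₂ h (algebraMap κ (integralClosure κ k))
          (AddMonoidAlgebra.singleZeroRingHom (M := S)) c
        rw [he, map_zero] at this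
        exact this.symm
      have h2 : IsIntegral (AddMonoidAlgebra κ S)
          (AddMonoidAlgebra.single s 1 : AddMonoidAlgebra (integralClosure κ k) S) := by
        have : (AddMonoidAlgebra.single s 1 : AddMonoidAlgebra (integralClosure κ k) S) =
            algebraMap (AddMonoidAlgebra κ S) _ (AddMonoidAlgebra.single s 1) := by
          refine ((AddMonoidAlgebra.mapRingHom_single ..).trans ?_).symm
          rw [map_one]
        rw [this]
        exact isIntegral_algebraMap
      have h3 := h1.mul h2
      rwa [AddMonoidAlgebra.single_mul_single, zero_add, mul_one] at h3
  change Function.Injective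
    (AddMonoidAlgebra.lift (integralClosure κ k) k S F).toRingHom
  rw [RingHom.injective_iff_ker_eq_bot]
  -- The larger monoid algebra is a domain integral over `κ[S]`, so a non-zero kernel would meet
  -- `κ[S]` non-trivially.
  refine Ideal.eq_bot_of_comap_eq_bot (R := AddMonoidAlgebra κ S) ?_
  rw [eq_bot_iff]
  intro x hx
  rw [Ideal.mem_comap, RingHom.mem_ker] at hx
  exact hF (((hincl x).symm.trans hx).trans (map_zero _).symm)

/-- If the kernel of `D[S] → k` consists of the elements with coefficients in `p`, the images of the
monomials are linearly independent over the residue field of `p`. -/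
lemma lift_residueField_injective {D k S : Type*} [CommRing D] [Field k] [AddCancelCommMonoid S]
    {p : Ideal D} [p.IsPrime] [Algebra p.ResidueField k] (ψ : AddMonoidAlgebra D S →+* k)
    (hψ : ∀ f, ψ f = 0 → ∀ s, f.coeff s ∈ p)
    (hD : ∀ d, ψ (algebraMap D _ d) = algebraMap p.ResidueField k (algebraMap D _ d))
    (F : Multiplicative S →* k) (hF : ∀ s : S, F (.ofAdd s) = ψ (AddMonoidAlgebra.single s 1)) :
    Function.Injective (AddMonoidAlgebra.lift p.ResidueField k S F) := by
  let red : AddMonoidAlgebra D S →+* AddMonoidAlgebra p.ResidueField S :=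
    AddMonoidAlgebra.mapRingHom S (algebraMap D p.ResidueField)
  have hred : ∀ f, AddMonoidAlgebra.lift p.ResidueField k S F (red f) = ψ f := by
    intro f
    induction f using AddMonoidAlgebra.induction_linear with
    | zero => simp
    | add x y hx hy => simp only [map_add, hx, hy]
    | single s c =>
      have : AddMonoidAlgebra.single s c =
          algebraMap D (AddMonoidAlgebra D S) c * AddMonoidAlgebra.single s 1 := by
        simp [AddMonoidAlgebra.single_mul_single]
      conv_rhs => rw [this, map_mul ψ, hD, ← hF, ← Algebra.smul_def]
      simp only [red, AddMonoidAlgebra.mapRingHom_single]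
      exact AddMonoidAlgebra.lift_single ..
  have hden : ∀ g : AddMonoidAlgebra p.ResidueField S, ∃ d ∉ p, ∃ f,
      algebraMap D p.ResidueField d • g = red f := by
    intro g
    induction g using AddMonoidAlgebra.induction_linear with
    | zero => exact ⟨1, p.one_notMem, 0, by simp⟩
    | add x y hx hy =>
      obtain ⟨d, hd, f, hf⟩ := hx
      obtain ⟨e, he, g, hg⟩ := hy
      refine ⟨d * e, fun h => (Ideal.IsPrime.mem_or_mem ‹_› h).elim hd he,
        algebraMap D _ e * f + algebraMap D _ d * g, ?_⟩
      have h : ∀ d, red (algebraMap D _ d) = algebraMap _ _ (algebraMap D p.ResidueField d) :=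
        fun d => AddMonoidAlgebra.mapRingHom_single ..
      rw [map_add, map_mul red, map_mul red, ← hf, ← hg, h, h, ← Algebra.smul_def,
        ← Algebra.smul_def, smul_smul, smul_smul, map_mul, smul_add, mul_comm]
    | single s c =>
      obtain ⟨a, b, hb, rfl⟩ := IsFractionRing.div_surjective (A := D ⧸ p) c
      obtain ⟨a, rfl⟩ := Ideal.Quotient.mk_surjective a
      obtain ⟨b, rfl⟩ := Ideal.Quotient.mk_surjective b
      have hb0 : b ∉ p := fun h =>
        nonZeroDivisors.ne_zero hb (Ideal.Quotient.eq_zero_iff_mem.mpr h)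
      refine ⟨b, hb0, AddMonoidAlgebra.single s a, ?_⟩
      have hb1 : algebraMap D p.ResidueField b ≠ 0 := by
        rwa [Ne, Ideal.algebraMap_residueField_eq_zero]
      simp only [red, AddMonoidAlgebra.mapRingHom_single, AddMonoidAlgebra.smul_single,
        Ideal.algebraMap_quotient_residueField_mk, smul_eq_mul]
      congr 1
      field_simp
  rw [injective_iff_map_eq_zero]
  intro g hg
  obtain ⟨d, hd, f, hf⟩ := hden g
  have hd' : algebraMap D p.ResidueField d ≠ 0 := by
    rwa [Ne, Ideal.algebraMap_residueField_eq_zero]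
  have hf0 : red f = 0 := by
    ext s
    rw [AddMonoidAlgebra.coeff_mapRingHom, AddMonoidAlgebra.coeff_zero, Finsupp.zero_apply,
      Ideal.algebraMap_residueField_eq_zero]
    refine hψ f ?_ s
    rw [← hred, ← hf, map_smul, hg, smul_zero]
  rw [hf0] at hf
  exact (smul_eq_zero.mp hf).resolve_left hd'

lemma eq_zero_of_sum_integral_mul_eq_zero {D k S : Type*} [CommRing D] [Field k]
    [AddCancelCommMonoid S] [UniqueSums S]
    {p : Ideal D} [p.IsPrime] [Algebra p.ResidueField k] (ψ : AddMonoidAlgebra D S →+* k)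
    (hψ : ∀ f, ψ f = 0 → ∀ s, f.coeff s ∈ p)
    (hD : ∀ d, ψ (algebraMap D _ d) = algebraMap p.ResidueField k (algebraMap D _ d))
    (c : S → k) (hc : ∀ s, IsIntegral p.ResidueField (c s)) (T : Finset S)
    (hT : ∑ s ∈ T, c s * ψ (AddMonoidAlgebra.single s 1) = 0) {s : S} (hs : s ∈ T) : c s = 0 := by
  classical
  let F : Multiplicative S →* k := (ψ : _ →* k).comp (AddMonoidAlgebra.of D S)
  have hinj := lift_integralClosure_injective F
    (lift_residueField_injective ψ hψ hD F fun s => rfl)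
  let e : S → integralClosure p.ResidueField k := fun s => ⟨c s, hc s⟩
  have hzero : ∑ s ∈ T, AddMonoidAlgebra.single s (e s) = 0 := by
    apply hinj
    rw [map_zero, map_sum, ← hT]
    refine Finset.sum_congr rfl fun s _ => ?_
    rw [AddMonoidAlgebra.lift_single]
    rfl
  have he : e s = 0 := by
    have := congrArg (fun y => y.coeff s) hzero
    simpa [Finsupp.single_apply, hs] using this
  exact congrArg Subtype.val he

lemma exists_residueField_map {D k : Type*} [CommRing D] [Field k] {p : Ideal D} [p.IsPrime]
    (φ : D →+* k) (hφ : ∀ d, φ d = 0 ↔ d ∈ p) :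
    ∃ ρ : p.ResidueField →+* k, ∀ d, ρ (algebraMap D _ d) = φ d :=
  ⟨Ideal.ResidueField.lift p φ (fun d hd => (hφ d).mpr hd)
    fun d hd => Ne.isUnit fun h => hd ((hφ d).mp h),
    fun _ => Ideal.ResidueField.lift_algebraMap ..⟩

/-- A valuation ring `W` of an extension `L` of the quotient field `K` of `D` which is centered on
`p[S]`, and in which the monomials of `D[S]` satisfy a linear relation, contains an element of `K`
with residue transcendental over `D / p`. -/
lemma exists_residue_transcendental {D S K L k : Type*} [CommRing D] [IsDomain D]
    [AddCancelCommMonoid S] [UniqueSums S] [Field K] [Field L] [Field k] [Algebra D K] [IsFractionRing D K]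
    {p : Ideal D} (hp : p.IsPrime) (f : AddMonoidAlgebra D S →+* L) (j : K →+* L)
    (hj : ∀ d, j (algebraMap D K d) = f (algebraMap D _ d))
    (W : ValuationSubring L) (r : W →+* k) (g : AddMonoidAlgebra D S →+* W) (hg : ∀ b, (g b : L) = f b)
    (hgM : ∀ b, r (g b) = 0 ↔ b ∈ extIdeal S p)
    {x : AddMonoidAlgebra D S} (hx0 : x ≠ 0) (hx : f x = 0) :
    ∃ (u : K) (w : W), (w : L) = j u ∧ ∀ h : D[X],
      h.eval₂ ((r.comp g).comp (algebraMap D _))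
        (r w) = 0 → ∀ i, h.coeff i ∈ p := by
  classical
  let ψ : AddMonoidAlgebra D S →+* k := r.comp g
  have hψ : ∀ x, ψ x = 0 ↔ x ∈ extIdeal S p := hgM
  -- Otherwise every element of `K` in `W` has residue algebraic over the residue field of `p`.
  by_contra! H
  obtain ⟨ρ, hρ'⟩ := exists_residueField_map (ψ.comp (algebraMap D _)) fun d =>
    (hψ _).trans algebraMap_mem_extIdeal
  let : Algebra p.ResidueField k := ρ.toAlgebra
  have hρ : ∀ d, ψ (algebraMap D _ d) = algebraMap p.ResidueField k (algebraMap D _ d) :=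
    fun d => (hρ' d).symm
  have hint : ∀ (u : K) (w : W), (w : L) = j u →
      IsIntegral p.ResidueField (r w) := by
    intro u w huw
    obtain ⟨h, hh, i, hi⟩ := H u w huw
    refine IsAlgebraic.isIntegral ⟨h.map (algebraMap D p.ResidueField), fun h0 => hi ?_, ?_⟩
    · rw [← Ideal.algebraMap_residueField_eq_zero, ← Polynomial.coeff_map, h0,
        Polynomial.coeff_zero]
    · rw [Polynomial.aeval_def, Polynomial.eval₂_map]
      rwa [show (algebraMap p.ResidueField k).comp (algebraMap D p.ResidueField) =
        ψ.comp (algebraMap D _) from RingHom.ext fun d => (hρ d).symm]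
  have hsupp : x.coeff.support.Nonempty := by simpa using hx0
  -- Dividing the relation `f x = 0` by a coefficient of largest valuation puts all coefficients in
  -- `W` and makes one of them `1`. Its reduction is a non-trivial relation with algebraic
  -- coefficients between residues of monomials, which is impossible.
  obtain ⟨s₀, hs₀, hmax⟩ := x.coeff.support.exists_max_image
    (fun s => W.valuation (j (algebraMap D K (x.coeff s)))) hsupp
  have hjinj : ∀ d, j (algebraMap D K d) = 0 → d = 0 := fun d hd =>
    IsFractionRing.injective D K (((map_eq_zero j).mp hd).trans (map_zero _).symm)
  have hc0 : j (algebraMap D K (x.coeff s₀)) ≠ 0 := fun h =>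
    Finsupp.mem_support_iff.mp hs₀ (hjinj _ h)
  have hmem : ∀ s, j (algebraMap D K (x.coeff s) / algebraMap D K (x.coeff s₀)) ∈ W := by
    intro s
    rw [← ValuationSubring.valuation_le_one_iff, map_div₀, map_div₀]
    apply div_le_one_of_le₀ _ zero_le
    by_cases hs : s ∈ x.coeff.support
    · exact hmax s hs
    · rw [Finsupp.notMem_support_iff.mp hs, map_zero, map_zero, map_zero]
      exact zero_le
  let c : S → W := fun s => ⟨_, hmem s⟩
  have hsum : ∑ s ∈ x.coeff.support, c s * g (AddMonoidAlgebra.single s 1) = 0 := by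
    apply Subtype.ext
    push_cast
    have : ∀ s, ((c s : L) * (g (AddMonoidAlgebra.single s 1) : L)) =
        f (AddMonoidAlgebra.single s (x.coeff s)) / j (algebraMap D K (x.coeff s₀)) := by
      intro s
      have h1 : AddMonoidAlgebra.single s (x.coeff s) =
          algebraMap D (AddMonoidAlgebra D S) (x.coeff s) * AddMonoidAlgebra.single s 1 := by
        simp [AddMonoidAlgebra.single_mul_single]
      rw [h1, map_mul f, ← hj, hg]
      change j (_ / _) * _ = _
      rw [map_div₀, div_mul_eq_mul_div]
    simp only [this]
    rw [← Finset.sum_div, ← map_sum]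
    have h2 : ∑ s ∈ x.coeff.support, AddMonoidAlgebra.single s (x.coeff s) = x :=
      AddMonoidAlgebra.sum_coeff_single x
    rw [h2, hx, zero_div]
  have hc1 : c s₀ = 1 := Subtype.ext (by
    change j _ = 1
    rw [map_div₀, div_self hc0])
  have hsum' := congrArg r hsum
  simp only [map_sum, map_mul, map_zero] at hsum'
  have h0 := eq_zero_of_sum_integral_mul_eq_zero ψ (fun x hx => (hψ x).mp hx) hρ (fun s => r (c s))
    (fun s => hint _ (c s) rfl) x.coeff.support hsum' hs₀
  rw [hc1, map_one] at h0
  exact one_ne_zero h0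

/-- The upper is the kernel of `X ↦ u`; for `u = b / a` it contains `aX - b`. Reducing `h(u) = 0` in
`W` shows that `h` kills the residue of `u`, so its coefficients lie in `p`. -/
lemma exists_upper_to_zero_of_residue_transcendental {D B K L : Type*} [CommRing D] [IsDomain D]
    [CommRing B] [Algebra D B] [Field K] [Field L] [Algebra D K] [IsFractionRing D K]
    {p : Ideal D} (f : B →+* L) (j : K →+* L)
    (hj : ∀ d, j (algebraMap D K d) = f (algebraMap D _ d))
    (W : ValuationSubring L) (g : B →+* W) (hg : ∀ b, (g b : L) = f b)
    {u : K} {w : W} (huw : (w : L) = j u) (htr : ∀ h : D[X],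
      h.eval₂ (((IsLocalRing.residue W).comp g).comp (algebraMap D _))
        (IsLocalRing.residue W w) = 0 → ∀ i, h.coeff i ∈ p) :
    ∃ U : Ideal D[X], U.IsPrime ∧ U ≠ ⊥ ∧ U.comap Polynomial.C = ⊥ ∧
      ∀ h ∈ U, ∀ i, h.coeff i ∈ p := by
  refine ⟨RingHom.ker (Polynomial.eval₂RingHom (algebraMap D K) u), RingHom.ker_isPrime _,
    ?_, ?_, ?_⟩
  · obtain ⟨b, a, ha, rfl⟩ := IsFractionRing.div_surjective (A := D) u
    have ha0 : a ≠ 0 := nonZeroDivisors.ne_zero ha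
    have ha' : algebraMap D K a ≠ 0 := by
      rwa [Ne, map_eq_zero_iff _ (IsFractionRing.injective D K)]
    rw [Submodule.ne_bot_iff]
    refine ⟨Polynomial.C a * Polynomial.X - Polynomial.C b, ?_, fun h => ha0 ?_⟩
    · rw [RingHom.mem_ker]
      simp only [map_sub, map_mul, Polynomial.coe_eval₂RingHom, Polynomial.eval₂_C,
        Polynomial.eval₂_X]
      field_simp
      ring
    · have := congrArg (fun q => Polynomial.coeff q 1) h
      simpa [Polynomial.coeff_C] using this
  · rw [eq_bot_iff]
    intro d hd
    rw [Ideal.mem_comap, RingHom.mem_ker, Polynomial.coe_eval₂RingHom, Polynomial.eval₂_C,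
      map_eq_zero_iff _ (IsFractionRing.injective D K)] at hd
    exact hd
  · intro h hh
    apply htr
    rw [RingHom.mem_ker, Polynomial.coe_eval₂RingHom] at hh
    have h1 : h.eval₂ (g.comp (algebraMap D _)) w = 0 := by
      apply Subtype.ext
      have := Polynomial.hom_eval₂ h (g.comp (algebraMap D _)) W.subtype w
      refine this.trans ?_
      change h.eval₂ _ (w : L) = 0
      rw [huw]
      have h2 := Polynomial.hom_eval₂ h (algebraMap D K) j u
      rw [hh, map_zero] at h2
      rw [h2]
      congr 1
      exact RingHom.ext fun d => (hg _).trans (hj d).symm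
    have h3 := Polynomial.hom_eval₂ h (g.comp (algebraMap D _)) (IsLocalRing.residue W) w
    rw [h1, map_zero] at h3
    exact h3.symm

/-- If `p[S]` contains a non-zero prime lying over `(0)`, then `p[X]` contains an upper to zero. -/
theorem exists_upper_to_zero_of_le_extIdeal {D S : Type*} [CommRing D] [IsDomain D]
    [AddCancelCommMonoid S] [UniqueSums S] {p : Ideal D} (hp : p.IsPrime)
    {Q : Ideal (AddMonoidAlgebra D S)} (hQ : Q.IsPrime) (hQ0 : Q ≠ ⊥)
    (hQD : Q.comap (algebraMap D _) = ⊥) (hQp : Q ≤ extIdeal S p) :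
    ∃ U : Ideal D[X], U.IsPrime ∧ U ≠ ⊥ ∧ U.comap Polynomial.C = ⊥ ∧
      ∀ h ∈ U, ∀ i, h.coeff i ∈ p := by
  let L := FractionRing (AddMonoidAlgebra D S ⧸ Q)
  let f : AddMonoidAlgebra D S →+* L := (algebraMap (AddMonoidAlgebra D S ⧸ Q) L).comp
    (Ideal.Quotient.mk Q)
  have hf : ∀ x, f x = 0 ↔ x ∈ Q := fun x => by
    rw [RingHom.comp_apply, map_eq_zero_iff _ (IsFractionRing.injective _ L),
      Ideal.Quotient.eq_zero_iff_mem]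
  have hfD : Function.Injective (f.comp (algebraMap D _)) := by
    rw [injective_iff_map_eq_zero]
    intro d hd
    have : d ∈ Q.comap (algebraMap D _) := (hf _).mp hd
    rwa [hQD, Ideal.mem_bot] at this
  let j : FractionRing D →+* L := IsFractionRing.lift hfD
  have hj : ∀ d, j (algebraMap D _ d) = f (algebraMap D _ d) := fun d =>
    IsFractionRing.lift_algebraMap hfD d
  clear_value f j
  obtain ⟨W, g, hg, hgM⟩ := exists_valuationSubring_center f (extIdeal_isPrime hp)
    (fun x hx => hQp ((hf x).mp hx))
  obtain ⟨x, hxQ, hx0⟩ := (Submodule.ne_bot_iff Q).mp hQ0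
  obtain ⟨u, w, huw, htr⟩ := exists_residue_transcendental hp f j hj W
    (IsLocalRing.residue W) g hg hgM hx0
    ((hf x).mpr hxQ)
  exact exists_upper_to_zero_of_residue_transcendental f j hj W g hg huw htr

end Valuation

/-! ### Extensions of height-one primes -/

section HeightOne

variable {D S : Type*} [CommRing D] [IsDomain D] [AddCancelCommMonoid S] [UniqueSums S]

/-- A height-one prime of `D[S]` which meets `D` non-trivially is extended from a height-one prime
of `D`. -/
lemma eq_extIdeal_of_height_eq_one {Q : Ideal (AddMonoidAlgebra D S)} (hQ : Q.IsPrime)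
    (hQ1 : Q.height = 1) (hQD : Q.comap (algebraMap D _) ≠ ⊥) :
    (Q.comap (algebraMap D _)).height = 1 ∧ Q = extIdeal S (Q.comap (algebraMap D _)) := by
  have hmin := ((height_eq_one_iff hQ).mp hQ1).2
  have hp : (Q.comap (algebraMap D _)).IsPrime := hQ.comap _
  have hext : ∀ q : Ideal D, q.IsPrime → q ≠ ⊥ → q ≤ Q.comap (algebraMap D _) →
      extIdeal S q = Q := fun q hq hq0 hqQ =>
    hmin _ (extIdeal_isPrime hq) (extIdeal_le_of_forall_algebraMap_mem fun a ha => hqQ ha)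
      (extIdeal_ne_bot hq0)
  refine ⟨(height_eq_one_iff hp).mpr ⟨hQD, fun q hq hqQ hq0 => ?_⟩,
    (hext _ hp hQD le_rfl).symm⟩
  rw [← hext q hq hq0 hqQ, comap_extIdeal]

/-- A non-zero prime inside `p[S]` lies either over zero, which would yield an upper inside `p[X]`,
or over `p`, and then it contains `p[S]`. -/
lemma extIdeal_height_eq_one {p : Ideal D} (hp : p.IsPrime) (h1 : p.height = 1)
    (hU : ∀ U : Ideal D[X], U.IsPrime → U ≠ ⊥ → U.comap Polynomial.C = ⊥ →
      ∃ h ∈ U, ∃ i, h.coeff i ∉ p) : (extIdeal S p).height = 1 := by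
  rw [height_eq_one_iff (extIdeal_isPrime hp)]
  refine ⟨extIdeal_ne_bot (Ideal.ne_bot_of_height_eq_one h1), fun Q hQ hQp hQ0 => ?_⟩
  have hle : Q.comap (algebraMap D _) ≤ p := (Ideal.comap_mono hQp).trans comap_extIdeal.le
  by_cases hQD : Q.comap (algebraMap D _) = ⊥
  · obtain ⟨U, h1, h2, h3, h4⟩ := exists_upper_to_zero_of_le_extIdeal hp hQ hQ0 hQD hQp
    obtain ⟨h, hh, i, hi⟩ := hU U h1 h2 h3
    exact absurd (h4 h hh i) hi
  · have := ((height_eq_one_iff hp).mp h1).2 _ (hQ.comap _) hle hQD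
    refine le_antisymm hQp (extIdeal_le_of_forall_algebraMap_mem fun a ha => ?_)
    rw [← this] at ha
    exact ha

/-- The extension to `D[X]` of a height-one prime of `D` is a `t`-ideal. -/
lemma isTIdeal_map_C {p : Ideal D} (hp : p.IsPrime) (h1 : p.height = 1) :
    IsTIdeal (p.map (Polynomial.C : D →+* D[X])) := by
  classical
  refine isTIdeal_of_separating fun J hJ hJp y hy => ?_
  obtain ⟨T, rfl⟩ := hJ
  rw [Ideal.mem_map_C_iff] at hy
  push Not at hy
  obtain ⟨i, hi⟩ := hy
  obtain ⟨c, a, ha, hca, hcy⟩ := exists_separating_fraction hp h1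
    (J := Ideal.span (T.biUnion Polynomial.coeffs : Finset D)) ⟨_, rfl⟩ (by
      rw [Ideal.span_le]
      intro d hd
      rw [Finset.mem_coe, Finset.mem_biUnion] at hd
      obtain ⟨f, hf, hd⟩ := hd
      obtain ⟨n, -, rfl⟩ := Polynomial.mem_coeffs_iff.mp hd
      exact Ideal.mem_map_C_iff.mp (hJp (Ideal.subset_span hf)) n) hi
  refine ⟨Polynomial.C c, Polynomial.C a, by simpa using ha, fun j hj => ?_, fun h => hcy ?_⟩
  · induction hj using Submodule.span_induction with
    | mem f hf =>
      rw [Polynomial.C_dvd_iff_dvd_coeff]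
      intro n
      rw [Polynomial.coeff_C_mul]
      by_cases hn : f.coeff n = 0
      · simp [hn]
      · exact hca _ (Ideal.subset_span (Finset.mem_coe.mpr (Finset.mem_biUnion.mpr
          ⟨f, hf, Polynomial.coeff_mem_coeffs hn⟩)))
    | zero => simp
    | add x y _ _ hx hy => rw [mul_add]; exact dvd_add hx hy
    | smul r x _ hx => rw [smul_eq_mul, mul_left_comm]; exact hx.mul_left r
  · rw [Polynomial.C_dvd_iff_dvd_coeff] at h
    simpa using h i

/-- If `U ⊆ p[X]`, then maximality of `U` among proper `t`-ideals gives `p[X] ⊆ U`, although `U`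
contains no non-zero constant. -/
lemma IsUMTDomain.exists_coeff_notMem (hD : IsUMTDomain D) {p : Ideal D} (hp : p.IsPrime)
    (h1 : p.height = 1) {U : Ideal D[X]} (hU : U.IsPrime) (hU0 : U ≠ ⊥)
    (hUD : U.comap Polynomial.C = ⊥) : ∃ h ∈ U, ∃ i, h.coeff i ∉ p := by
  by_contra! H
  have hle : U ≤ p.map Polynomial.C := fun h hh => Ideal.mem_map_C_iff.mpr (H h hh)
  have hprime : (p.map (Polynomial.C : D →+* D[X])).IsPrime := Ideal.isPrime_map_C_of_isPrime
  have := (hD U hU hU0 hUD).2 (y := p.map Polynomial.C)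
    ⟨hprime.ne_top, isTIdeal_map_C hp h1⟩ hle
  apply Ideal.ne_bot_of_height_eq_one h1
  rw [eq_bot_iff, ← hUD]
  exact fun a ha => this (Ideal.mem_map_of_mem _ ha)

end HeightOne

/-! ### Testing divisibility by constants and by monomials -/

section Divisibility

variable {D S : Type*} [CommRing D] [IsDomain D] [AddCancelCommMonoid S]

/-- As `p` has height one, `dD_p ∩ D` is `p`-primary (or the whole of `D`), and so the factor `b ∉
p[S]` can be cancelled modulo its extension. -/
lemma exists_dvd_mul_coeff [UniqueSums S] {p : Ideal D} (hp : p.IsPrime) (h1 : p.height = 1)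
    {d : D} (hd : d ≠ 0) {b g : AddMonoidAlgebra D S} (hb : b ∉ extIdeal S p)
    (hdvd : algebraMap D _ d ∣ b * g) (s : S) : ∃ c ∉ p, d ∣ c * g.coeff s := by
  have hle : Ideal.span {d} ≤ localizedSpan p d := by
    rw [Ideal.span_singleton_le_iff_mem]
    exact ⟨1, hp.one_notMem, by simp⟩
  have := mem_of_mul_mem_coeffIdeal (N := fun _ : S => localizedSpan p d) (P := fun _ => p)
    (hN := fun _ _ => le_rfl) (hP := fun _ _ => le_rfl)
    (fun s a ha => exists_dvd_mul_pow_of_height_eq_one hp h1 hd ha)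
    (fun s t a c ha hac => by
      obtain ⟨e, he, h⟩ := hac
      exact ⟨e * a, fun h => (hp.mem_or_mem h).elim he ha, by rwa [mul_assoc]⟩) hb
    (fun s => hle (Ideal.mem_span_singleton.mpr (algebraMap_dvd_iff.mp hdvd s)))
  exact this s

/-- Over a weakly Krull domain `D`, divisibility by a constant in `D[S]` can be tested at the
extensions of the height-one primes. -/
lemma algebraMap_dvd_of_forall_height_one [UniqueSums S] (hD : IsWeaklyKrullDomain D) {d : D}
    (hd : d ≠ 0) {g : AddMonoidAlgebra D S}
    (h : ∀ p : Ideal D, p.IsPrime → p.height = 1 →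
      ∃ b ∉ extIdeal S p, algebraMap D _ d ∣ b * g) : algebraMap D _ d ∣ g := by
  rw [algebraMap_dvd_iff]
  intro s
  refine (isWeaklyKrullDomain_iff.mp hD).1 _ _ hd fun p hp hp1 => ?_
  obtain ⟨b, hb, hdvd⟩ := h p hp hp1
  exact exists_dvd_mul_coeff hp hp1 hd hb hdvd s

/-- The localization of `S` at a minimal prime is primary. -/
lemma exists_nsmul_add_eq {S : Type*} [AddCancelCommMonoid S] {P : Set S}
    (hP : P ∈ minimalPrimeIdeals S) {s : S} (hs : s ∈ P) (v : S) :
    ∃ k : ℕ, ∃ f ∉ P, ∃ u, k • s + f = v + u := by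
  by_contra! H
  have h0 : (0 : S) ∉ P := fun h => hP.1.2.ne_univ
    (Set.eq_univ_of_forall fun t => by simpa using hP.1.2.add_mem t h)
  -- This set contains `v` by `H`, lies inside `P` (take `k = 0`, `f = t`, `u = 0`) and omits `s`
  -- (take `k = 1`). Being prime, it contradicts the minimality of `P`.
  have hprime : IsPrimeIdeal {t : S | ∀ (k : ℕ), ∀ f ∉ P, ∀ u, k • s + f ≠ t + u} := by
    refine ⟨fun r t ht k f hf u h => ht k f hf (r + u) (by rw [h]; abel), fun h => ?_,
      fun {a b} hab => ?_⟩
    · have : (0 : S) ∈ {t : S | ∀ (k : ℕ), ∀ f ∉ P, ∀ u, k • s + f ≠ t + u} :=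
        h ▸ Set.mem_univ _
      exact this 0 0 h0 0 (by simp)
    · by_contra! hn
      obtain ⟨ha, hb⟩ := hn
      simp only [Set.mem_ofPred_eq, not_forall, not_not] at ha hb
      obtain ⟨k, f, hf, u, h⟩ := ha
      obtain ⟨k', f', hf', u', h'⟩ := hb
      refine hab (k + k') (f + f') (fun h => (hP.1.2.mem_or_mem h).elim hf hf') (u + u') ?_
      rw [add_add_add_comm a, ← h, ← h', add_nsmul]
      abel
  refine hP.2 (y := {t : S | ∀ (k : ℕ), ∀ f ∉ P, ∀ u, k • s + f ≠ t + u})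
    ⟨⟨v, H⟩, hprime⟩ (fun t ht => ?_) hs 1 0 h0 0 (by simp)
  by_contra htP
  exact ht 0 t htP 0 (by simp)

/-- The monoid analogue of `exists_dvd_mul_coeff`: `(t + S_P) ∩ S` plays the role of the primary
ideal, by `exists_nsmul_add_eq`. -/
lemma exists_add_eq_of_mem_support [UniqueSums S] {P : Set S} (hP : P ∈ minimalPrimeIdeals S)
    {t : S} {b g : AddMonoidAlgebra D S}
    (hb : b ∉ monIdeal D P fun s _ => hP.1.2.add_mem s)
    (hdvd : AddMonoidAlgebra.single t 1 ∣ b * g) {s : S} (hs : s ∈ g.coeff.support) :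
    ∃ f ∉ P, ∃ u, s + f = t + u := by
  have h0 : (0 : S) ∉ P := fun h => hP.1.2.ne_univ
    (Set.eq_univ_of_forall fun t => by simpa using hP.1.2.add_mem t h)
  have hN : ∀ r, ∀ s ∈ {s | ∃ f ∉ P, ∃ u, s + f = t + u},
      r + s ∈ {s | ∃ f ∉ P, ∃ u, s + f = t + u} := by
    rintro r s ⟨f, hf, u, h⟩
    exact ⟨f, hf, r + u, by rw [add_assoc, h]; abel⟩
  refine mem_monIdeal.mp (mem_monIdeal_of_mul_mem (hN := hN) (fun s hs => ?_)
    (fun s s' hs h => ?_) hb (mem_monIdeal.mpr fun s hs => ?_)) s hs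
  · obtain ⟨k, f, hf, u, h⟩ := exists_nsmul_add_eq hP hs t
    exact ⟨k, f, hf, u, h⟩
  · obtain ⟨f, hf, u, h⟩ := h
    refine ⟨s + f, fun h => (hP.1.2.mem_or_mem h).elim hs hf, u, ?_⟩
    rw [← h]
    abel
  · obtain ⟨u, hu⟩ := single_one_dvd_iff.mp hdvd s hs
    exact ⟨0, h0, u, by rw [hu, add_zero]⟩

/-- Over a weakly Krull monoid `S`, divisibility by a monomial in `D[S]` can be tested at the
ideals `D[P]` for the minimal primes `P` of `S`. -/
lemma single_one_dvd_of_forall_minimal [UniqueSums S] (hS : IsWeaklyKrullMonoid S) {t : S}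
    {g : AddMonoidAlgebra D S} (h : ∀ P, ∀ hP : P ∈ minimalPrimeIdeals S,
      ∃ b ∉ monIdeal D P fun s _ => hP.1.2.add_mem s, AddMonoidAlgebra.single t 1 ∣ b * g) :
    AddMonoidAlgebra.single t 1 ∣ g := by
  rw [single_one_dvd_iff]
  intro s hs
  have hmem : GrothendieckAddGroup.of s - GrothendieckAddGroup.of t ∈
      Set.range (GrothendieckAddGroup.of : S →+ GrothendieckAddGroup S) := by
    rw [← hS.iInter_localization_eq]
    simp only [Set.mem_iInter]
    intro P hP
    obtain ⟨b, hb, hdvd⟩ := h P hP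
    obtain ⟨f, hf, u, hu⟩ := exists_add_eq_of_mem_support hP hb hdvd hs
    refine ⟨u, f, hf, ?_⟩
    rw [sub_eq_sub_iff_add_eq_add, ← map_add, hu, map_add, add_comm]
  obtain ⟨u, hu⟩ := hmem
  refine ⟨u, GrothendieckAddGroup.of_injective ?_⟩
  rw [map_add, hu]
  abel

end Divisibility

/-! ### Sufficiency -/

section Main

variable {D S : Type*} [CommRing D] [IsDomain D] [AddCancelCommMonoid S] [AddMonoid.FG S]
  [IsAddTorsionFree S]

/-- Height-one primes of `K[G]` contract to height-one primes of `D[S]`, so `x / y` lies in the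
factorial ring `K[G]`, whose denominators over `D[S]` are monomials. -/
lemma exists_dvd_single_mul {x y : AddMonoidAlgebra D S} (hy : y ≠ 0)
    (h : ∀ Q : Ideal (AddMonoidAlgebra D S), Q.IsPrime → Q.height = 1 → ∃ b ∉ Q, y ∣ b * x) :
    ∃ d ≠ 0, ∃ t, y ∣ AddMonoidAlgebra.single t d * x := by
  let G := GrothendieckAddGroup S
  let K := FractionRing D
  let φ : S →+ G := GrothendieckAddGroup.of
  let : Algebra (AddMonoidAlgebra D S) (AddMonoidAlgebra K G) :=
    (monoidAlgebraMap D K φ).toAlgebra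
  have hloc : IsLocalization (monomials D⁰ (⊤ : AddSubmonoid S)) (AddMonoidAlgebra K G) :=
    isLocalization_monoidAlgebraMap (IsFractionRing.injective D K)
      GrothendieckAddGroup.of_injective (fun s _ => AddGroup.isAddUnit _) fun t => by
        obtain ⟨⟨a, b⟩, h⟩ := (AddLocalization.addMonoidOf (⊤ : AddSubmonoid S)).surj t
        exact ⟨b, trivial, a, h⟩
  have hinj : Function.Injective (algebraMap (AddMonoidAlgebra D S) (AddMonoidAlgebra K G)) :=
    monoidAlgebraMap_injective (IsFractionRing.injective D K) GrothendieckAddGroup.of_injective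
  have := uniqueFactorizationMonoid_addMonoidAlgebra K G
  obtain ⟨w, hw⟩ := dvd_of_forall_height_one_of_ufd (algebraMap _ (AddMonoidAlgebra K G) x)
    (algebraMap _ _ y) (by rwa [Ne, map_eq_zero_iff _ hinj]) fun P hP hP1 => by
      obtain ⟨b, hb, hdvd⟩ := h (P.under _) (hP.comap _) (by
        rwa [IsLocalization.height_under (monomials D⁰ (⊤ : AddSubmonoid S))])
      refine ⟨algebraMap _ _ b, hb, ?_⟩
      rw [← map_mul]
      exact map_dvd _ hdvd
  obtain ⟨⟨g, ⟨_, d, hd, t, _, rfl⟩⟩, hg⟩ := IsLocalization.surj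
    (monomials D⁰ (⊤ : AddSubmonoid S)) w
  refine ⟨d, nonZeroDivisors.ne_zero hd, t, g, hinj ?_⟩
  rw [map_mul, map_mul, hw, ← hg]
  ring

theorem isWeaklyKrullDomain_addMonoidAlgebra (hD : IsWeaklyKrullDomain D)
    (hext : ∀ p : Ideal D, p.IsPrime → p.height = 1 → (extIdeal S p).height = 1)
    (hS : IsWeaklyKrullMonoid S) : IsWeaklyKrullDomain (AddMonoidAlgebra D S) := by
  rw [isWeaklyKrullDomain_iff]
  refine ⟨fun x y hy h => ?_, fun f hf => ?_⟩
  · obtain ⟨d, hd, t, g, hg⟩ := exists_dvd_single_mul hy h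
    have hsingle : AddMonoidAlgebra.single t d =
        AddMonoidAlgebra.single t 1 * algebraMap D (AddMonoidAlgebra D S) d := by
      simp [AddMonoidAlgebra.single_mul_single]
    rw [hsingle] at hg
    obtain ⟨g, rfl⟩ : AddMonoidAlgebra.single t 1 ∣ g := by
      refine single_one_dvd_of_forall_minimal hS fun P hP => ?_
      obtain ⟨b, hb, a, ha⟩ := h _ (monIdeal_isPrime hP.1.2) (monIdeal_height_eq_one hP)
      refine ⟨b, hb, algebraMap D _ d * a, mul_left_cancel₀ hy ?_⟩
      rw [mul_left_comm, ← hg, mul_left_comm, ha]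
      ring
    have ht : (AddMonoidAlgebra.single t 1 : AddMonoidAlgebra D S) ≠ 0 := by simp
    have hg' : algebraMap D _ d * x = y * g := mul_left_cancel₀ ht (by
      rw [← mul_assoc, hg]; ring)
    obtain ⟨g, rfl⟩ : algebraMap D _ d ∣ g := by
      refine algebraMap_dvd_of_forall_height_one hD hd fun p hp hp1 => ?_
      obtain ⟨b, hb, a, ha⟩ := h _ (extIdeal_isPrime hp) (hext p hp hp1)
      refine ⟨b, hb, a, mul_left_cancel₀ hy ?_⟩
      rw [mul_left_comm, ← hg', mul_left_comm, ha]
      ring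
    have hd' : algebraMap D (AddMonoidAlgebra D S) d ≠ 0 := by simpa using hd
    exact ⟨g, mul_left_cancel₀ hd' (by rw [hg']; ring)⟩
  · obtain ⟨s, hs⟩ : ∃ s, f.coeff s ≠ 0 := by
      by_contra! H
      exact hf (AddMonoidAlgebra.ext (Finsupp.ext H))
    -- A height-one prime over zero is handled in `K[S]`; any other is some `p[S]`, where `p`
    -- contains the fixed non-zero coefficient of `f`.
    refine ((finite_height_one_of_comap_eq_bot hf).union
      (((isWeaklyKrullDomain_iff.mp hD).2 _ hs).image (extIdeal S))).subset ?_
    rintro Q ⟨hQ, hQ1, hfQ⟩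
    by_cases hQD : Q.comap (algebraMap D _) = ⊥
    · exact Or.inl ⟨⟨hQ, hQ1, hfQ⟩, hQD⟩
    · obtain ⟨h1, h2⟩ := eq_extIdeal_of_height_eq_one hQ hQ1 hQD
      rw [h2] at hfQ
      exact Or.inr ⟨_, ⟨hQ.comap _, h1, hfQ s⟩, h2.symm⟩

end Main

/-! ### Descent to `D` and to `S` -/

section Necessity

lemma exists_mem_forall_notMem {A : Type*} [CommRing A] {F : Set (Ideal A)} (hF : F.Finite)
    (hprime : ∀ Q ∈ F, Q.IsPrime) {I : Ideal A} (hI : ∀ Q ∈ F, ¬ I ≤ Q) :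
    ∃ y ∈ I, ∀ Q ∈ F, y ∉ Q := by
  have := (Ideal.subset_union_prime_finite hF (f := id) ⊥ ⊥ (fun Q hQ _ _ => hprime Q hQ)
    (I := I)).not.mpr (by push Not; exact hI)
  obtain ⟨y, hy, hyF⟩ := Set.not_subset.mp this
  simp only [Set.mem_iUnion, not_exists] at hyF
  exact ⟨y, hy, fun Q hQ h => hyF Q hQ h⟩

variable {D S : Type*} [CommRing D] [IsDomain D] [AddCancelCommMonoid S] [UniqueSums S]

/-- If `D[S]` is weakly Krull, height-one primes of `D` extend to height-one primes of `D[S]`. -/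
theorem extIdeal_height_eq_one_of_isWeaklyKrullDomain
    (hA : IsWeaklyKrullDomain (AddMonoidAlgebra D S)) {p : Ideal D} (hp : p.IsPrime)
    (h1 : p.height = 1) : (extIdeal S p).height = 1 := by
  classical
  by_contra hne
  rw [isWeaklyKrullDomain_iff] at hA
  have hprime := extIdeal_isPrime (S := S) hp
  have hbot := extIdeal_ne_bot (S := S) (Ideal.ne_bot_of_height_eq_one h1)
  obtain ⟨a, hap, ha0⟩ := (Submodule.ne_bot_iff p).mp (Ideal.ne_bot_of_height_eq_one h1)
  have hx0 : algebraMap D (AddMonoidAlgebra D S) a ≠ 0 := by simpa using ha0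
  -- A height-one prime containing `p[S]` would equal it, so `p[S]` lies in none of the finitely
  -- many height-one primes containing `a`, and prime avoidance applies.
  obtain ⟨y, hy, hyF⟩ := exists_mem_forall_notMem (hA.2 _ hx0) (fun Q hQ => hQ.1)
    (I := extIdeal S p) fun Q hQ hle => hne (by
      rw [((height_eq_one_iff hQ.1).mp hQ.2.1).2 _ hprime hle hbot]
      exact hQ.2.1)
  obtain ⟨c, α, hα, hca, hc⟩ := exists_separating_fraction hp h1
    (J := Ideal.span ((insert a (y.coeff.support.image y.coeff) : Finset D) : Set D))
    ⟨_, rfl⟩ (by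
      rw [Ideal.span_le, Finset.coe_insert, Set.insert_subset_iff]
      refine ⟨hap, fun d hd => ?_⟩
      rw [Finset.mem_coe, Finset.mem_image] at hd
      obtain ⟨s, -, rfl⟩ := hd
      exact hy s) hp.one_notMem
  apply hc
  have hα0 : algebraMap D (AddMonoidAlgebra D S) α ≠ 0 := by simpa using hα
  -- Both `a` and `y` carry `c / α` into `D[S]`, and each height-one prime omits one of them. Hence
  -- `α ∣ c`, against the choice of the fraction.
  have hdvd := hA.1 (algebraMap D _ c) (algebraMap D _ α) hα0 fun Q hQ hQ1 => by
    by_cases haQ : algebraMap D _ a ∈ Q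
    · refine ⟨y, hyF Q ⟨hQ, hQ1, haQ⟩, ?_⟩
      rw [algebraMap_dvd_iff]
      intro s
      rw [mul_comm, AddMonoidAlgebra.coe_algebraMap, Function.comp_apply,
        AddMonoidAlgebra.coeff_single_zero_mul]
      by_cases hs : y.coeff s = 0
      · simp [hs]
      · refine hca _ (Ideal.subset_span (Finset.mem_coe.mpr (Finset.mem_insert_of_mem
          (Finset.mem_image_of_mem _ (Finsupp.mem_support_iff.mpr hs)))))
    · refine ⟨_, haQ, ?_⟩
      rw [← map_mul, mul_comm]
      exact map_dvd _ (hca _ (Ideal.subset_span (Finset.mem_coe.mpr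
        (Finset.mem_insert_self _ _))))
  simpa using algebraMap_dvd_iff.mp hdvd 0

theorem isWeaklyKrullDomain_of_addMonoidAlgebra
    (hA : IsWeaklyKrullDomain (AddMonoidAlgebra D S)) : IsWeaklyKrullDomain D := by
  have hext := fun (p : Ideal D) hp h1 =>
    extIdeal_height_eq_one_of_isWeaklyKrullDomain hA (p := p) hp h1
  rw [isWeaklyKrullDomain_iff] at hA ⊢
  refine ⟨fun x y hy h => ?_, fun x hx => ?_⟩
  · have hy0 : algebraMap D (AddMonoidAlgebra D S) y ≠ 0 := by simpa using hy
    have hdvd := hA.1 (algebraMap D _ x) (algebraMap D _ y) hy0 fun Q hQ hQ1 => by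
      -- Primes over zero impose no condition, since `y` itself is a denominator there.
      by_cases hQD : Q.comap (algebraMap D _) = ⊥
      · refine ⟨algebraMap D _ y, fun hyQ => hy ?_, dvd_mul_right _ _⟩
        rwa [← Ideal.mem_comap, hQD, Ideal.mem_bot] at hyQ
      · obtain ⟨b, hb, hdvd⟩ := h _ (hQ.comap _) (eq_extIdeal_of_height_eq_one hQ hQ1 hQD).1
        refine ⟨algebraMap D _ b, hb, ?_⟩
        rw [← map_mul]
        exact map_dvd _ hdvd
    simpa using algebraMap_dvd_iff.mp hdvd 0
  · have hx0 : algebraMap D (AddMonoidAlgebra D S) x ≠ 0 := by simpa using hx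
    have hinj : Function.Injective (extIdeal S : Ideal D → _) :=
      Function.LeftInverse.injective (g := Ideal.comap (algebraMap D _)) fun _ => comap_extIdeal
    refine ((hA.2 _ hx0).preimage hinj.injOn).subset ?_
    rintro p ⟨hp, h1, hxp⟩
    exact ⟨extIdeal_isPrime hp, hext p hp h1, algebraMap_mem_extIdeal.mpr hxp⟩

lemma setOf_single_mem_mem_minimalPrimeIdeals {Q : Ideal (AddMonoidAlgebra D S)} (hQ : Q.IsPrime)
    (hQ1 : Q.height = 1) (hne : {s : S | AddMonoidAlgebra.single s 1 ∈ Q}.Nonempty) :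
    {s : S | AddMonoidAlgebra.single s 1 ∈ Q} ∈ minimalPrimeIdeals S := by
  refine ⟨⟨hne, isPrimeIdeal_setOf_single_mem hQ⟩, fun P hP hPQ s hs => ?_⟩
  have := ((height_eq_one_iff hQ).mp hQ1).2 _ (monIdeal_isPrime hP.2)
    (monIdeal_le_of_forall_single_mem fun s hs => hPQ hs) (monIdeal_ne_bot hP.1)
  rw [Set.mem_ofPred_eq, ← this, single_one_mem_monIdeal] at hs
  exact hs

theorem isWeaklyKrullMonoid_of_addMonoidAlgebra [AddMonoid.FG S]
    (hA : IsWeaklyKrullDomain (AddMonoidAlgebra D S)) : IsWeaklyKrullMonoid S := by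
  rw [isWeaklyKrullDomain_iff] at hA
  refine ⟨Set.Subset.antisymm (fun x hx => ?_) ?_, fun a _ => ?_⟩
  · obtain ⟨⟨a, b⟩, hab⟩ := (AddLocalization.addMonoidOf (⊤ : AddSubmonoid S)).surj x
    replace hab : x + GrothendieckAddGroup.of (b : S) = GrothendieckAddGroup.of a := hab
    obtain ⟨b, hb⟩ := b
    have hdvd := hA.1 (AddMonoidAlgebra.single a 1) (AddMonoidAlgebra.single b 1)
      (by simp) fun Q hQ hQ1 => by
        -- A prime without monomials imposes no condition; otherwise its monomials form a minimal
        -- prime of `S`.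
        rcases Set.eq_empty_or_nonempty {s : S | AddMonoidAlgebra.single s 1 ∈ Q} with h | h
        · exact ⟨AddMonoidAlgebra.single b 1, fun hbQ => Set.eq_empty_iff_forall_notMem.mp h b hbQ,
            dvd_mul_right _ _⟩
        · have hmem := Set.mem_iInter₂.mp hx _ (setOf_single_mem_mem_minimalPrimeIdeals hQ hQ1 h)
          obtain ⟨u, v, hv, rfl⟩ := hmem
          refine ⟨AddMonoidAlgebra.single v 1, hv, AddMonoidAlgebra.single u 1, ?_⟩
          rw [AddMonoidAlgebra.single_mul_single, AddMonoidAlgebra.single_mul_single]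
          congr 1
          apply GrothendieckAddGroup.of_injective
          rw [map_add, map_add, ← hab]
          dsimp only
          abel
    obtain ⟨u, hu⟩ := single_one_dvd_iff.mp hdvd a (by simp)
    refine ⟨u, ?_⟩
    rw [hu, map_add, add_comm x] at hab
    exact (add_left_cancel hab).symm
  · rintro _ ⟨s, rfl⟩
    refine Set.mem_iInter₂.mpr fun P hP => ⟨s, 0, fun h => hP.1.2.ne_univ
      (Set.eq_univ_of_forall fun t => by simpa using hP.1.2.add_mem t h), by simp⟩
  · refine ((hA.2 (AddMonoidAlgebra.single a 1) (by simp)).image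
      fun Q => {s : S | AddMonoidAlgebra.single s 1 ∈ Q}).subset ?_
    rintro P ⟨hP, haP⟩
    refine ⟨monIdeal D P fun s _ => hP.1.2.add_mem s, ⟨monIdeal_isPrime hP.1.2,
      monIdeal_height_eq_one hP, single_one_mem_monIdeal.mpr haP⟩, ?_⟩
    ext s
    exact single_one_mem_monIdeal (hP := fun s _ => hP.1.2.add_mem s)

end Necessity

/-! ### Restriction to a line in the exponent group -/

section Line

/-- Restriction to a line `t + ℤ s` turns multiplication by a polynomial in `X^s` into
multiplication by a Laurent polynomial. -/
lemma comapDomain_eval₂_mul {D G : Type*} [CommRing D] [AddCommGroup G] (t s : G)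
    (h : Function.Injective fun k : ℤ => t + k • s) (f : D[X]) (g : AddMonoidAlgebra D G) :
    (AddMonoidAlgebra.comapDomain _ h
        (f.eval₂ (algebraMap D _) (AddMonoidAlgebra.single s 1) * g) : AddMonoidAlgebra D ℤ) =
      (Polynomial.toLaurent f : AddMonoidAlgebra D ℤ) * AddMonoidAlgebra.comapDomain _ h g := by
  induction f using Polynomial.induction_on' with
  | add f₁ f₂ h₁ h₂ =>
    rw [Polynomial.eval₂_add, add_mul, AddMonoidAlgebra.comapDomain_add, h₁, h₂, map_add, add_mul]
  | monomial n a =>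
    have h1 : (Polynomial.monomial n a).eval₂ (algebraMap D (AddMonoidAlgebra D G))
        (AddMonoidAlgebra.single s 1) = AddMonoidAlgebra.single (n • s) a := by
      rw [Polynomial.eval₂_monomial, AddMonoidAlgebra.single_pow, AddMonoidAlgebra.coe_algebraMap,
        Function.comp_apply, AddMonoidAlgebra.single_mul_single]
      simp
    have h2 : (Polynomial.toLaurent (Polynomial.monomial n a) : AddMonoidAlgebra D ℤ) =
        AddMonoidAlgebra.single (n : ℤ) a := by
      rw [← Polynomial.C_mul_X_pow_eq_monomial, Polynomial.toLaurent_C_mul_X_pow,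
        LaurentPolynomial.single_eq_C_mul_T]
    rw [h1, h2]
    ext k
    rw [AddMonoidAlgebra.coeff_single_mul_apply, AddMonoidAlgebra.coeff_comapDomain,
      AddMonoidAlgebra.coeff_comapDomain, Finsupp.comapDomain_apply, Finsupp.comapDomain_apply,
      AddMonoidAlgebra.coeff_single_mul_apply]
    congr 2
    rw [add_smul, neg_smul, natCast_zsmul]
    abel

/-- Clearing powers of `T` gives `f * g' * X ^ n = a * (h' * X ^ m)` in `D[X]`. Since `a ∉ U`, the
prime `U` contains `h' * X ^ m`, whose coefficient at `n + m` is the constant coefficient of `h`. -/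
lemma coeff_zero_mem_of_toLaurent_mul_eq {D : Type*} [CommRing D] {U : Ideal D[X]} (hU : U.IsPrime)
    {p : Ideal D} (hUp : ∀ f ∈ U, ∀ i, f.coeff i ∈ p) {f : D[X]} (hf : f ∈ U) {a : D}
    (ha : Polynomial.C a ∉ U) {g h : LaurentPolynomial D}
    (hgh : Polynomial.toLaurent f * g = LaurentPolynomial.C a * h) :
    AddMonoidAlgebra.coeff h 0 ∈ p := by
  obtain ⟨m, g', hg⟩ := LaurentPolynomial.exists_T_pow g
  obtain ⟨n, h', hh⟩ := LaurentPolynomial.exists_T_pow h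
  have key : f * g' * Polynomial.X ^ n = Polynomial.C a * (h' * Polynomial.X ^ m) := by
    apply Polynomial.toLaurent_injective
    simp only [map_mul, Polynomial.toLaurent_X_pow, Polynomial.toLaurent_C, hg, hh]
    linear_combination (LaurentPolynomial.T n * LaurentPolynomial.T m) * hgh
  have hmem : h' * Polynomial.X ^ m ∈ U := (hU.mem_or_mem (key ▸ by
    rw [mul_assoc]; exact U.mul_mem_right _ hf)).resolve_left ha
  have := hUp _ hmem (n + m)
  rw [Polynomial.coeff_mul_X_pow] at this
  have e1 : AddMonoidAlgebra.coeff (Polynomial.toLaurent h') (n : ℤ) = h'.coeff n := by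
    rw [Polynomial.toLaurent_apply]
    exact Finsupp.mapDomain_apply Nat.cast_injective _ _
  rwa [← e1, hh, LaurentPolynomial.T, AddMonoidAlgebra.coeff_mul_single_apply, mul_one,
    add_neg_cancel] at this

end Line

/-! ### Height one of `p[S]` excludes uppers inside `p[X]` -/

section Contraction

variable {D S : Type*} [CommRing D] [IsDomain D] [AddCancelCommMonoid S] [IsAddTorsionFree S]
  [UniqueSums S]

/-- If `p[S]` has height one in `D[S]`, then `p[X]` contains no non-zero prime of `D[X]` lying
over zero. -/
lemma exists_coeff_notMem_of_extIdeal_height_eq_one [Nontrivial S] {p : Ideal D} (hp : p.IsPrime)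
    (hp0 : p ≠ ⊥) (h1 : (extIdeal S p).height = 1) {U : Ideal D[X]} (hU : U.IsPrime) (hU0 : U ≠ ⊥)
    (hUD : U.comap Polynomial.C = ⊥) : ∃ h ∈ U, ∃ i, h.coeff i ∉ p := by
  by_contra! H
  obtain ⟨f, hfU, hf0⟩ := (Submodule.ne_bot_iff U).mp hU0
  obtain ⟨a, hap, ha0⟩ := (Submodule.ne_bot_iff p).mp hp0
  obtain ⟨s, hs⟩ := exists_ne (0 : S)
  let G := GrothendieckAddGroup S
  let φ : S →+ G := GrothendieckAddGroup.of
  have hφ : Function.Injective φ := GrothendieckAddGroup.of_injective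
  have hφs : φ s ≠ 0 := by rwa [Ne, map_eq_zero_iff _ hφ]
  have hline : ∀ t : G, Function.Injective fun k : ℤ => t + k • φ s := fun t k l hkl =>
    smul_left_injective ℤ hφs (add_left_cancel hkl)
  let ι := monoidAlgebraMap D D φ
  let x : AddMonoidAlgebra D S := f.eval₂ (algebraMap D _) (AddMonoidAlgebra.single s 1)
  have hx : ι x = f.eval₂ (algebraMap D _) (AddMonoidAlgebra.single (φ s) 1) := by
    simp only [x]
    rw [Polynomial.hom_eval₂]
    congr 1
    · ext d : 1
      simp [ι]
    · simp [ι]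
  -- On the line through `0`, the element `x` restricts to `f` viewed as a Laurent polynomial.
  have hx0 : x ≠ 0 := by
    intro h0
    have := comapDomain_eval₂_mul 0 (φ s) (hline 0) f 1
    rw [← hx, h0, map_zero, zero_mul, AddMonoidAlgebra.comapDomain_zero] at this
    have e : (AddMonoidAlgebra.comapDomain _ (hline 0) (1 : AddMonoidAlgebra D G)) = 1 := by
      have e0 := AddMonoidAlgebra.comapDomain_single_map (R := D) _ (hline 0) (0 : ℤ) 1
      rw [zero_smul, zero_add] at e0
      exact e0
    rw [e, mul_one] at this
    exact hf0 (Polynomial.toLaurent_injective (by rw [map_zero]; exact this.symm))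
  -- Height one makes `x` divide `h * a ^ n` for some `h ∉ p[S]`. Restriction to the line through an
  -- exponent `t` with `h.coeff t ∉ p` moves this coefficient to degree `0`.
  obtain ⟨n, h, hh, g, hg⟩ := exists_dvd_mul_pow_of_height_eq_one
    (extIdeal_isPrime (S := S) hp) h1 hx0 (algebraMap_mem_extIdeal.mpr hap)
  rw [mem_extIdeal] at hh
  push Not at hh
  obtain ⟨t, ht⟩ := hh
  apply ht
  have key := comapDomain_eval₂_mul (φ t) (φ s) (hline (φ t)) f (ι g)
  have hC : Polynomial.C (a ^ n) ∉ U := by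
    intro h
    rw [← Ideal.mem_comap, hUD, Ideal.mem_bot] at h
    exact pow_ne_zero n ha0 h
  have hgh : Polynomial.toLaurent f * (AddMonoidAlgebra.comapDomain _ (hline (φ t)) (ι g)) =
      LaurentPolynomial.C (a ^ n) *
        (AddMonoidAlgebra.comapDomain _ (hline (φ t)) (ι h) : LaurentPolynomial D) := by
    have key' := comapDomain_eval₂_mul (φ t) (φ s) (hline (φ t)) (Polynomial.C (a ^ n)) (ι h)
    rw [Polynomial.eval₂_C, Polynomial.toLaurent_C] at key'
    have hι : ι (algebraMap D _ (a ^ n)) = algebraMap D _ (a ^ n) := by simp [ι]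
    refine key.symm.trans (Eq.trans ?_ key')
    rw [← hx, ← hι, ← map_mul, ← map_mul, ← hg, map_pow, mul_comm]
  have := coeff_zero_mem_of_toLaurent_mul_eq hU H hfU hC hgh
  rw [AddMonoidAlgebra.coeff_comapDomain, Finsupp.comapDomain_apply, zero_smul, add_zero] at this
  rwa [coeff_monoidAlgebraMap hφ] at this

end Contraction

/-! ### Uppers to zero as maximal `t`-ideals -/

section UpperToZero

variable {D : Type*} [CommRing D] [IsDomain D]

attribute [local instance] Polynomial.algebra Polynomial.isLocalization in
/-- An ideal of `D[X]` strictly above a non-zero prime lying over zero contains a non-zero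
constant. -/
lemma exists_C_mem_of_lt {R I : Ideal D[X]} (hR : R.IsPrime) (hR0 : R ≠ ⊥)
    (hRD : R.comap Polynomial.C = ⊥) (hlt : R < I) : ∃ d ≠ 0, Polynomial.C d ∈ I := by
  by_contra! H
  let M : Submonoid D[X] := D⁰.map (Polynomial.C : D →+* D[X])
  let K := FractionRing D
  have hloc : IsLocalization M K[X] := inferInstance
  have hdR : Disjoint (M : Set D[X]) R := by
    rw [Set.disjoint_left]
    rintro _ ⟨d, hd, rfl⟩ hdR
    have : d ∈ R.comap Polynomial.C := hdR
    rw [hRD, Ideal.mem_bot] at this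
    exact nonZeroDivisors.ne_zero hd this
  have hdI : Disjoint (M : Set D[X]) I := by
    rw [Set.disjoint_left]
    rintro _ ⟨d, hd, rfl⟩ hdI
    exact H d (nonZeroDivisors.ne_zero hd) hdI
  have hprime : (R.map (algebraMap D[X] K[X])).IsPrime :=
    IsLocalization.isPrime_of_isPrime_disjoint M K[X] R hR hdR
  have hback : (R.map (algebraMap D[X] K[X])).under D[X] = R :=
    IsLocalization.under_map_of_isPrime_disjoint M K[X] hR hdR
  -- `K[X]` is a principal ideal domain, so the non-zero prime `R K[X]` is maximal; an ideal `I`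
  -- without non-zero constants stays proper in `K[X]` and hence cannot exceed `R`.
  have hmax : (R.map (algebraMap D[X] K[X])).IsMaximal := by
    refine IsPrime.to_maximal_ideal (hpi := hprime) fun h => hR0 ?_
    rw [← hback, h]
    refine Ideal.comap_bot_of_injective _ (IsLocalization.injective K[X] (M := M) ?_)
    rintro _ ⟨d, hd, rfl⟩
    exact mem_nonZeroDivisors_of_ne_zero
      (Polynomial.C_ne_zero.mpr (nonZeroDivisors.ne_zero hd))
  have htop : I.map (algebraMap D[X] K[X]) ≠ ⊤ :=
    (IsLocalization.map_algebraMap_ne_top_iff_disjoint M K[X] I).mpr hdI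
  have heq := hmax.eq_of_le htop (Ideal.map_mono hlt.le)
  refine hlt.not_ge ?_
  rw [← hback, heq]
  exact Ideal.le_comap_map

lemma height_eq_one_of_comap_C_eq_bot {U : Ideal D[X]} (hU : U.IsPrime) (hU0 : U ≠ ⊥)
    (hUD : U.comap Polynomial.C = ⊥) : U.height = 1 := by
  rw [height_eq_one_iff hU]
  refine ⟨hU0, fun Q hQ hQU hQ0 => ?_⟩
  have hQD : Q.comap Polynomial.C = ⊥ := by
    rw [eq_bot_iff, ← hUD]
    exact Ideal.comap_mono hQU
  by_contra hne
  obtain ⟨d, hd, hdU⟩ := exists_C_mem_of_lt hQ hQ0 hQD (lt_of_le_of_ne hQU hne)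
  rw [← Ideal.mem_comap, hUD, Ideal.mem_bot] at hdU
  exact hd hdU

lemma C_dvd_of_forall_height_one (hD : IsWeaklyKrullDomain D) {d : D} (hd : d ≠ 0) {g : D[X]}
    (h : ∀ p : Ideal D, p.IsPrime → p.height = 1 →
      ∃ b : D[X], (∃ i, b.coeff i ∉ p) ∧ Polynomial.C d ∣ b * g) : Polynomial.C d ∣ g := by
  have hC : ∀ f : D[X], Polynomial.C d ∣ f ↔
      algebraMap D (AddMonoidAlgebra D ℕ) d ∣ Polynomial.toFinsuppIso D f := fun f =>
    (map_dvd_iff (Polynomial.toFinsuppIso D)).symm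
  rw [hC]
  refine algebraMap_dvd_of_forall_height_one hD hd fun p hp hp1 => ?_
  obtain ⟨b, ⟨i, hi⟩, hb⟩ := h p hp hp1
  rw [hC, map_mul] at hb
  exact ⟨_, fun h => hi (h i), hb⟩

/-- A weakly Krull domain is a UMT-domain as soon as no extension `p[X]` of a height-one prime
contains an upper to zero. -/
theorem isUMTDomain_of_isWeaklyKrullDomain (hD : IsWeaklyKrullDomain D)
    (hU : ∀ p : Ideal D, p.IsPrime → p.height = 1 → ∀ U : Ideal D[X], U.IsPrime → U ≠ ⊥ →
      U.comap Polynomial.C = ⊥ → ∃ h ∈ U, ∃ i, h.coeff i ∉ p) : IsUMTDomain D := by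
  intro Q hQ hQ0 hQD
  refine ⟨⟨hQ.ne_top, isTIdeal_of_height_eq_one hQ (height_eq_one_of_comap_C_eq_bot hQ hQ0 hQD)⟩,
    fun I ⟨hI1, hI⟩ hQI => ?_⟩
  by_contra hne
  obtain ⟨d, hd, hdI⟩ := exists_C_mem_of_lt hQ hQ0 hQD (lt_of_le_not_ge hQI hne)
  -- Only finitely many height-one `p` contain `d`, and `I` lies in no such `p[X]` because `Q` does
  -- not.
  obtain ⟨h, hh, hF⟩ := exists_mem_forall_notMem
    (((isWeaklyKrullDomain_iff.mp hD).2 d hd).image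
      (Ideal.map (Polynomial.C : D →+* D[X]))) (by
        rintro _ ⟨p, ⟨hp, -, -⟩, rfl⟩
        exact Ideal.isPrime_map_C_of_isPrime) (I := I) (by
        rintro _ ⟨p, ⟨hp, hp1, -⟩, rfl⟩ hle
        obtain ⟨f, hf, i, hi⟩ := hU p hp hp1 Q hQ hQ0 hQD
        exact hi (Ideal.mem_map_C_iff.mp (hle (hQI hf)) i))
  refine hI1 (hI.eq_top_of_trivial_inverse (J := Ideal.span {Polynomial.C d, h})
    (Submodule.fg_span (Set.toFinite _)) ?_ ?_ fun c a ha hca => ?_)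
  · rw [Ideal.span_le, Set.insert_subset_iff, Set.singleton_subset_iff]
    exact ⟨hdI, hh⟩
  · intro hbot
    have : Polynomial.C d ∈ (⊥ : Ideal D[X]) := hbot ▸ Ideal.subset_span (by simp)
    simp [hd] at this
  · obtain ⟨k, hk⟩ := hca _ (Ideal.subset_span (by simp : Polynomial.C d ∈ _))
    obtain ⟨l, hl⟩ := hca _ (Ideal.subset_span (by simp : h ∈ _))
    have hd' : (Polynomial.C d) ≠ 0 := by simpa using hd
    -- From `c * d = a * k` and `c * h = a * l` follows `h * k = d * l`. Where `d ∈ p`, the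
    -- multiplier `h ∉ p[X]` shows that `d` divides `k` locally; elsewhere `d` is a unit. So `(d,
    -- h)` has trivial inverse.
    obtain ⟨k, rfl⟩ : Polynomial.C d ∣ k := by
      refine C_dvd_of_forall_height_one hD hd fun p hp hp1 => ?_
      by_cases hdp : d ∈ p
      · have := hF _ ⟨p, ⟨hp, hp1, hdp⟩, rfl⟩
        rw [Ideal.mem_map_C_iff] at this
        push Not at this
        refine ⟨h, this, l, mul_left_cancel₀ ha ?_⟩
        linear_combination h * hk.symm + Polynomial.C d * hl
      · exact ⟨Polynomial.C d, ⟨0, by simpa using hdp⟩, dvd_mul_right _ _⟩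
    exact ⟨k, mul_right_cancel₀ hd' (by rw [hk]; ring)⟩

end UpperToZero

end WeaklyKrull

theorem proposition2p14 (D : Type*) [CommRing D] [IsDomain D]
    (S : Type*) [AddCancelCommMonoid S] [AddMonoid.FG S] [IsAddTorsionFree S] [Nontrivial S] :
    WeaklyKrull.IsWeaklyKrullDomain (AddMonoidAlgebra D S) ↔
      (WeaklyKrull.IsWeaklyKrullDomain D ∧ WeaklyKrull.IsUMTDomain D) ∧
        WeaklyKrull.IsWeaklyKrullMonoid S := by
  constructor
  · intro hA
    have hD := WeaklyKrull.isWeaklyKrullDomain_of_addMonoidAlgebra hA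
    exact ⟨⟨hD, WeaklyKrull.isUMTDomain_of_isWeaklyKrullDomain hD fun p hp h1 U hU hU0 hUD =>
      WeaklyKrull.exists_coeff_notMem_of_extIdeal_height_eq_one hp
        (Ideal.ne_bot_of_height_eq_one h1)
        (WeaklyKrull.extIdeal_height_eq_one_of_isWeaklyKrullDomain hA hp h1) hU hU0 hUD⟩,
      WeaklyKrull.isWeaklyKrullMonoid_of_addMonoidAlgebra hA⟩
  · rintro ⟨⟨hD, hUMT⟩, hS⟩
    exact WeaklyKrull.isWeaklyKrullDomain_addMonoidAlgebra hD
      (fun p hp h1 => WeaklyKrull.extIdeal_height_eq_one hp h1 fun U hU hU0 hUD =>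
        hUMT.exists_coeff_notMem hp h1 hU hU0 hUD) hS
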